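/- Let $p:(0,\infty)\to(0,\infty)$ be a probability density with finite mean $\lambda^{-1}=\int_0^\infty x\,p(x)\,dx$, and let $A_1,A_2,\dots$ be i.i.d. with density $p$: the inter-packet delays of Jack's stream. Put $\tau(i)=\sum_{j\le i}A_j$ and $X(t)=\sup\{i:\tau(i)\le t\}$. For $x>0$ put $p^-(x,\rho)=(1-\rho)\,p((1-\rho)x)$ and assume: (i) $\partial_\rho^k\log p^-(x,\rho)$ exists for $k=1,2,3$, all $x>0$ and all $\rho\in(0,1)$; (ii) there are $\delta\in(0,1]$ and functions $F,G,H$ of $x$ alone with $\int_0^\infty F\,dx<\infty$, $\int_0^\infty G\,dx<\infty$, $\int_0^\infty pH\,dx<\infty$ such that $|\partial_\rho p^-|<F(x)$, $|\partial_\rho^2p^-|<G(x)$ and $|\partial_\rho^3\log p^-|<H(x)$ for all $x>0$ and $\rho\in(0,\delta)$; (iii) $\int_0^\infty\partial_\rho p^-(x,\rho)|_{\rho=0}\,dx=\int_0^\infty\partial_\rho^2p^-(x,\rho)|_{\rho=0}\,dx=0$. Bob receives packet $i$ at time $\tau(i)$. A buffering scheme of Bob is a (possibly randomized) sequence of transmission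 times $0=D_0\le D_1\le D_2\le\cdots$ with $D_i\ge\tau(i)$; when he transmits his $N$-th packet, his buffer holds $m_N=X(D_N)-N$ packets. The warden Willie, who knows $p$, $N$ and the scheme, observes the first $N$ inter-packet delays, either before Bob (where they are always $A_1,\dots,A_N$) or after Bob. He tests $H_0$ (the packets after Bob have the original times $\tau(i)$) against $H_1$ (they have the times $D_i$), with false-alarm probability $\mathbb P_{FA}$ and missed-detection probability $\mathbb P_{MD}$. **Constant.** The number $$c=-1+\int_0^\infty p(x)\,x^2\Bigl(\frac{d\log p(x)}{dx}\Bigr)^2dx$$ is finite and positive, and equals the Fisher information $\int_0^\infty \frac{1}{p(x)}\bigl(\partial_\rho p^-(x,\rho)|_{\rho=0}\bigr)^2dx$ (a convergent integral). **Achievability.** Let $0<\epsilon<1$ and $\rho_N=\epsilon/\sqrt{cN}$, and let Bob use the times $D_i=\tau(i)/(1-\rho_N)$ to transmit $N$ packets. For all large $N$ one has $0<\rho_N<1$ and this is almost surely a buffering scheme; the number of buffered packets satisfies $$\lim_{N\to\infty}\mathbb P\Bigl(m_N\ge\epsilon\sqrt{\tfrac{N}{4c}}\Bigr)=1,\qquad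 \lim_{N\to\infty}\mathbb P\Bigl(m_N\le\epsilon\sqrt{\tfrac{4N}{c}}\Bigr)=1;$$ and it is covert: for all sufficiently large $N$, for both locations of Willie and every measurable test on the first $N$ observed delays, $\mathbb P_{FA}+\mathbb P_{MD}\ge1-\epsilon$. **Converse.** Assume in addition that $p$ has finite variance $\sigma^2$. For $0<\alpha<1$ let Willie, located after Bob, reject $H_0$ if and only if the average $S$ of the first $N$ observed delays satisfies $S>\lambda^{-1}+\sqrt{\sigma^2/(\alpha N)}$. Then $\mathbb P_{FA}\le\alpha$ for every $N\ge1$. If Bob buffers $\omega(\sqrt N)$ packets while transmitting $N$ packets, by any buffering schemes (which may depend on $N$), meaning that $\lim_{N\to\infty}\mathbb P(m_N\ge K\sqrt N)=1$ for every $K$, then $\mathbb P_{MD}\to0$ as $N\to\infty$. In particular, for every $\eta>0$ there is $\alpha\in(0,1)$ such that against all such schemes $\mathbb P_{FA}+\mathbb P_{MD}<\eta$ for all sufficiently large $N$. -/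

import Mathlib

open MeasureTheory ProbabilityTheory Filter Topology Set

noncomputable section

namespace CovertBuffering

/-- The scaled density `p⁻(x, ρ) = (1 - ρ) p((1 - ρ) x)`. -/
def pMinus (p : ℝ → ℝ) (x ρ : ℝ) : ℝ := (1 - ρ) * p ((1 - ρ) * x)

/-- `p` is an inter-packet-delay density: a probability density on `(0, ∞)`, positive there,
with finite mean. Its values on `(-∞, 0]` are irrelevant. -/
structure IsDelayDensity (p : ℝ → ℝ) : Prop where
  pos : ∀ x, 0 < x → 0 < p x
  integrable : IntegrableOn p (Ioi 0)
  integral_eq_one : ∫ x in Ioi (0 : ℝ), p x = 1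
  integrable_mean : IntegrableOn (fun x => x * p x) (Ioi 0)

/-- The law on `ℝ` with density `p` on `(0, ∞)`. -/
def delayLaw (p : ℝ → ℝ) : Measure ℝ :=
  (volume.restrict (Ioi 0)).withDensity (fun x => ENNReal.ofReal (p x))

/-- The rate `λ = (∫ x p(x) dx)⁻¹`. -/
def rate (p : ℝ → ℝ) : ℝ := (∫ x in Ioi (0 : ℝ), x * p x)⁻¹

/-- The variance `σ²` of a delay with density `p`. -/
def delayVariance (p : ℝ → ℝ) : ℝ := ∫ x in Ioi (0 : ℝ), (x - (rate p)⁻¹) ^ 2 * p x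

/-- The regularity conditions on `p⁻`. The dominating functions `F`, `G`, `H` do not depend
on `ρ`; the bounds are required for `ρ` in some interval `(0, δ)`. -/
structure RegularityConditions (p : ℝ → ℝ) : Prop where
  /-- The first three `ρ`-derivatives of `log p⁻` exist. -/
  exists_derivs : ∀ x, 0 < x → ∀ ρ ∈ Ioo (0 : ℝ) 1, ∀ k < 3,
    DifferentiableAt ℝ (iteratedDeriv k (fun r => Real.log (pMinus p x r))) ρ
  dominated : ∃ δ : ℝ, 0 < δ ∧ δ ≤ 1 ∧ ∃ F G H : ℝ → ℝ,
    IntegrableOn F (Ioi 0) ∧ IntegrableOn G (Ioi 0) ∧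
    IntegrableOn (fun x => p x * H x) (Ioi 0) ∧
    ∀ ρ ∈ Ioo (0 : ℝ) δ, ∀ x, 0 < x →
      |deriv (fun r => pMinus p x r) ρ| < F x ∧
      |iteratedDeriv 2 (fun r => pMinus p x r) ρ| < G x ∧
      |iteratedDeriv 3 (fun r => Real.log (pMinus p x r)) ρ| < H x
  integral_deriv_zero : ∫ x in Ioi (0 : ℝ), deriv (fun r => pMinus p x r) 0 = 0
  integral_deriv_two_zero :
    ∫ x in Ioi (0 : ℝ), iteratedDeriv 2 (fun r => pMinus p x r) 0 = 0

/-- The constant `c = -1 + ∫ p(x) x² (d log p(x) / dx)² dx`. -/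
def bufferConst (p : ℝ → ℝ) : ℝ :=
  -1 + ∫ x in Ioi (0 : ℝ), p x * x ^ 2 * (deriv (fun y => Real.log (p y)) x) ^ 2

/-- `A 0, A 1, …` are the inter-packet delays of a renewal stream with delay density `p`. -/
structure IsRenewalStream {Ω : Type*} [MeasurableSpace Ω] (μ : Measure Ω) (p : ℝ → ℝ)
    (A : ℕ → Ω → ℝ) : Prop where
  measurable : ∀ i, Measurable (A i)
  indep : iIndepFun A μ
  law : ∀ i, μ.map (A i) = delayLaw p

/-- `τ(i)`, the arrival time of the `i`-th packet (`i ≥ 1`), with `τ(0) = 0`. -/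
def arrivalTime {Ω : Type*} (A : ℕ → Ω → ℝ) (i : ℕ) (ω : Ω) : ℝ :=
  ∑ j ∈ Finset.range i, A j ω

/-- `X(t) = sup {i : τ(i) ≤ t}`, the number of packets that have arrived by time `t`.
(Almost surely the set is bounded for a renewal stream.) -/
def arrivalCount {Ω : Type*} (A : ℕ → Ω → ℝ) (t : ℝ) (ω : Ω) : ℕ :=
  sSup {i : ℕ | arrivalTime A i ω ≤ t}

/-- Bob's possible behaviours: `D i` is the time of his `i`-th transmission (`i ≥ 1`; `D 0 = 0` is
the start). He only forwards received packets, so that the `i`-th transmission cannot precede the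
`i`-th arrival. Randomized behaviour is allowed, since `Ω` may carry more than the arrivals. -/
structure IsBufferingScheme {Ω : Type*} [MeasurableSpace Ω] (μ : Measure Ω)
    (A : ℕ → Ω → ℝ) (D : ℕ → Ω → ℝ) : Prop where
  measurable : ∀ i, Measurable (D i)
  start : ∀ᵐ ω ∂μ, D 0 ω = 0
  mono : ∀ᵐ ω ∂μ, Monotone (fun i => D i ω)
  causal : ∀ᵐ ω ∂μ, ∀ i, arrivalTime A i ω ≤ D i ω

/-- The number of packets in Bob's buffer when he transmits his `N`-th packet:
packets received by that time, minus `N`. -/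
def buffered {Ω : Type*} (A D : ℕ → Ω → ℝ) (N : ℕ) (ω : Ω) : ℝ :=
  (arrivalCount A (D N ω) ω : ℝ) - N

/-- The stretching scheme: a packet received at time `τ` is sent at time `τ / (1 - ρ)`. -/
def stretch {Ω : Type*} (A : ℕ → Ω → ℝ) (ρ : ℝ) (i : ℕ) (ω : Ω) : ℝ :=
  arrivalTime A i ω / (1 - ρ)

/-- The scaling parameter `ρ = ε / √(c N)`. -/
def stretchParam (p : ℝ → ℝ) (ε : ℝ) (N : ℕ) : ℝ := ε / √(bufferConst p * N)

/-- Willie's location: before Bob (between Alice and Bob) or after Bob (between Bob and Steve). -/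
inductive Location
  | aliceBob
  | bobSteve

/-- The packet times that Willie sees when Bob's transmission times are `D`. In the absence of
insertions by Alice, the packets between Alice and Bob carry their original timing. -/
def seenTimes {Ω : Type*} (A D : ℕ → Ω → ℝ) : Location → ℕ → Ω → ℝ
  | Location.aliceBob => arrivalTime A
  | Location.bobSteve => D

/-- The first `N` inter-packet delays of a stream with packet times `T 1, T 2, …` and `T 0 = 0`. -/
def delays {Ω : Type*} (T : ℕ → Ω → ℝ) (N : ℕ) (ω : Ω) : Fin N → ℝ :=
  fun i => T ((i : ℕ) + 1) ω - T (i : ℕ) ω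

/-- False-alarm probability of the test that rejects `H₀` (Bob relays the packets unmodified)
when the first `N` observed delays lie in `R`. -/
def probFA {Ω : Type*} [MeasurableSpace Ω] (μ : Measure Ω) (A : ℕ → Ω → ℝ) (N : ℕ)
    (R : Set (Fin N → ℝ)) : ℝ :=
  μ.real {ω | delays (arrivalTime A) N ω ∈ R}

/-- Missed-detection probability of the test with rejection region `R` when Bob uses `D` and
Willie is at `loc`. -/
def probMD {Ω : Type*} [MeasurableSpace Ω] (μ : Measure Ω) (A D : ℕ → Ω → ℝ)
    (loc : Location) (N : ℕ) (R : Set (Fin N → ℝ)) : ℝ :=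
  μ.real {ω | delays (seenTimes A D loc) N ω ∉ R}

/-- Rejection region of the threshold test: the average observed delay exceeds `λ⁻¹ + U`. -/
def thresholdRegion (p : ℝ → ℝ) (U : ℝ) (N : ℕ) : Set (Fin N → ℝ) :=
  {x | (rate p)⁻¹ + U < (∑ i, x i) / N}

/-- The threshold offset `U = √(σ² / (α N))`. -/
def threshold (p : ℝ → ℝ) (α : ℝ) (N : ℕ) : ℝ := √(delayVariance p / (α * N))

/-- `D N` is the scheme that Bob uses for transmitting `N` packets. He buffers `ω(√N)` packets: for
every `K`, the buffer content is at least `K √N` with probability tending to one. -/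
def BuffersOmegaSqrt {Ω : Type*} [MeasurableSpace Ω] (μ : Measure Ω) (A : ℕ → Ω → ℝ)
    (D : ℕ → ℕ → Ω → ℝ) : Prop :=
  ∀ K : ℝ, Tendsto (fun N : ℕ => μ.real {ω | K * √(N : ℝ) ≤ buffered A (D N) N ω}) atTop (𝓝 1)

end CovertBuffering

end

namespace CovertBuffering

/-! ### Derivatives of the scaled density through the single function `y p(y)` -/

section

/-! Write g(y) = y p(y) and h = log g. Since x p⁻(x, ρ) = g((1 - ρ)x), every ρ-derivative is a
derivative of g or h along an affine path. Regularity of log p⁻ at interior ρ therefore gives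
regularity of h on all of (0, ∞), hence also at ρ = 0, and the dominating bounds extend to ρ = 0 by
continuity.

Constant. Put s(x) = x h'(x) and s₂(x) = x² h''(x). Then ∂_ρ p⁻ = -p s and ∂_ρ² p⁻ = p(s² + s₂) at ρ
= 0, so ∫ p s = 0 and ∫ p s₂ = -∫ p s². Integrability of p s² is the delicate point. It follows from
a Landau-type inequality: a nonnegative function whose second derivative is at most M on an interval
of length d, starting at q with slope -a < 0, satisfies a² ≤ 2q(M + a/d) (`mul_scoreZero_sq_le`). As
x (log p)' = s - 1, the constant c is ∫ p s². If it vanished, x p(x) would be constant and p not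
integrable.

Covertness. Let V = √(p⁻/p). From exp u ≥ 1 + u and a third-order Taylor bound for log p⁻, the
affinity ∫ V p is at least 1 - cρ²/4 - Cρ³ (`exists_affinity_lower_bound`). Affinities multiply over
independent delays, so with ρ² = ε²/(cN) Bernoulli's inequality gives an N-fold affinity of at least
1 - ε²/4 - o(1), which exceeds 1 - ε²/2. That forces the two error probabilities of any test to sum
to at least 1 - ε (`one_sub_le_of_affinity`).

Buffer size. Almost surely m_N ≥ K means τ(N + ⌈K⌉) ≤ D_N. The stretch gains a time of about ρτ(N) ≈
ρN/λ, during which about ρN = ε√(N/c) packets arrive; the law of large numbers, applied to τ(N) and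
to the following block, gives this up to a factor 2.

Converse. Chebyshev bounds the false alarms. On a missed detection D_N exceeds N/λ by at most O(√N),
whereas K√N buffered packets force τ(N + ⌈K√N⌉) ≤ D_N. For large K this puts τ far below its mean,
which Chebyshev makes unlikely. -/

theorem deriv_comp_affine (f : ℝ → ℝ) (a b r : ℝ) :
    deriv (fun r => f (b + a * r)) r = a * deriv f (b + a * r) := by
  have h := deriv_comp_mul_left a (fun y => f (b + y)) r
  rw [h, deriv_comp_const_add, smul_eq_mul]

theorem iteratedDeriv_comp_affine (n : ℕ) (f : ℝ → ℝ) (a b : ℝ) :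
    iteratedDeriv n (fun r => f (b + a * r)) = fun r => a ^ n * iteratedDeriv n f (b + a * r) := by
  induction n with
  | zero => simp
  | succ n ih =>
    ext r
    rw [iteratedDeriv_succ, ih, deriv_const_mul_field, deriv_comp_affine (iteratedDeriv n f),
      iteratedDeriv_succ, pow_succ, mul_assoc]

/-- The density `y p(y)` of the logarithm of a delay, as a function of the delay. -/
noncomputable def logScaleDensity (p : ℝ → ℝ) (y : ℝ) : ℝ := y * p y

/-- The affine form of the argument is what lets `iteratedDeriv_comp_affine` compute all
ρ-derivatives at once. -/
theorem pMinus_eq (p : ℝ → ℝ) {x : ℝ} (hx : x ≠ 0) (r : ℝ) :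
    pMinus p x r = x⁻¹ * logScaleDensity p (x + (-x) * r) := by
  have : x + (-x) * r = (1 - r) * x := by ring
  rw [this, pMinus, logScaleDensity]
  field_simp

theorem iteratedDeriv_pMinus (p : ℝ → ℝ) {x : ℝ} (hx : x ≠ 0) (n : ℕ) (r : ℝ) :
    iteratedDeriv n (fun r => pMinus p x r) r =
      x⁻¹ * ((-x) ^ n * iteratedDeriv n (logScaleDensity p) (x + (-x) * r)) := by
  have : (fun r => pMinus p x r) = fun r => x⁻¹ * logScaleDensity p (x + (-x) * r) :=
    funext fun r => pMinus_eq p hx r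
  rw [this, iteratedDeriv_const_mul_field, iteratedDeriv_comp_affine]

theorem deriv_pMinus (p : ℝ → ℝ) {x : ℝ} (hx : x ≠ 0) (r : ℝ) :
    deriv (fun r => pMinus p x r) r = - deriv (logScaleDensity p) (x + (-x) * r) := by
  have h := iteratedDeriv_pMinus p hx 1 r
  rw [iteratedDeriv_one, iteratedDeriv_one] at h
  rw [h]
  field_simp

variable {p : ℝ → ℝ}

theorem IsDelayDensity.logScaleDensity_pos (hp : IsDelayDensity p) {y : ℝ} (hy : 0 < y) :
    0 < logScaleDensity p y := mul_pos hy (hp.pos y hy)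

theorem IsDelayDensity.pMinus_pos (hp : IsDelayDensity p) {x r : ℝ} (hx : 0 < x) (hr : r < 1) :
    0 < pMinus p x r :=
  mul_pos (by linarith) (hp.pos _ (mul_pos (by linarith) hx))

theorem add_neg_mul_pos {x r : ℝ} (hx : 0 < x) (hr : r < 1) : 0 < x + (-x) * r := by
  have : x + (-x) * r = x * (1 - r) := by ring
  rw [this]
  exact mul_pos hx (by linarith)

theorem iteratedDeriv_log_pMinus {x : ℝ} (hx : 0 < x) (r : ℝ) (n : ℕ) :
    iteratedDeriv n (fun r => Real.log (pMinus p x r)) r =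
      (-x) ^ n * iteratedDeriv n (fun y => Real.log (x⁻¹ * logScaleDensity p y))
        (x + (-x) * r) := by
  have : (fun r => Real.log (pMinus p x r)) = fun r =>
      (fun y => Real.log (x⁻¹ * logScaleDensity p y)) (x + (-x) * r) :=
    funext fun r => by rw [pMinus_eq p hx.ne' r]
  rw [this]
  exact congrFun (iteratedDeriv_comp_affine n
    (fun y => Real.log (x⁻¹ * logScaleDensity p y)) (-x) x) r

/-- The logarithm of `y p(y)`. -/
noncomputable def logDensity (p : ℝ → ℝ) (y : ℝ) : ℝ := Real.log (logScaleDensity p y)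

theorem log_const_mul_eventuallyEq (hp : IsDelayDensity p) {x y : ℝ} (hx : 0 < x) (hy : 0 < y) :
    (fun y => Real.log (x⁻¹ * logScaleDensity p y)) =ᶠ[𝓝 y]
      fun y => Real.log x⁻¹ + logDensity p y := by
  filter_upwards [lt_mem_nhds hy] with z hz
  rw [Real.log_mul (inv_pos.2 hx).ne' (hp.logScaleDensity_pos hz).ne', logDensity]

theorem iteratedDeriv_log_pMinus_succ (hp : IsDelayDensity p) {x r : ℝ} (hx : 0 < x)
    (hr : r < 1) (n : ℕ) :
    iteratedDeriv (n + 1) (fun r => Real.log (pMinus p x r)) r =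
      (-x) ^ (n + 1) * iteratedDeriv (n + 1) (logDensity p) (x + (-x) * r) := by
  rw [iteratedDeriv_log_pMinus hx,
    (log_const_mul_eventuallyEq hp hx (add_neg_mul_pos hx hr)).iteratedDeriv_eq]
  congr 1
  rw [iteratedDeriv_succ', iteratedDeriv_succ']
  congr 1
  ext y
  rw [deriv_const_add]

/-- The additive constant `log x⁻¹` survives only in the derivative of order zero. Equality near
`r`, not just at `r`, is needed to transfer differentiability. -/
theorem iteratedDeriv_log_pMinus_eventuallyEq (hp : IsDelayDensity p) {x r : ℝ} (hx : 0 < x)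
    (hr : r < 1) (k : ℕ) :
    (iteratedDeriv k fun r => Real.log (pMinus p x r)) =ᶠ[𝓝 r]
      fun r => (-x) ^ k * ((if k = 0 then Real.log x⁻¹ else 0) +
        iteratedDeriv k (logDensity p) (x + (-x) * r)) := by
  filter_upwards [gt_mem_nhds hr] with r hr
  cases k with
  | zero =>
    have := (log_const_mul_eventuallyEq hp hx (add_neg_mul_pos hx hr)).eq_of_nhds
    simp only [iteratedDeriv_zero, pow_zero, if_true, one_mul]
    rw [pMinus_eq p hx.ne' r, this]
  | succ n => rw [iteratedDeriv_log_pMinus_succ hp hx hr n]; simp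

theorem differentiableAt_iteratedDeriv_logDensity (hp : IsDelayDensity p)
    (hreg : RegularityConditions p) {y : ℝ} (hy : 0 < y) {k : ℕ} (hk : k < 3) :
    DifferentiableAt ℝ (iteratedDeriv k (logDensity p)) y := by
  have hx : (0 : ℝ) < 2 * y := by linarith
  -- The hypothesis covers only interior ρ, but every y > 0 equals (1 - ρ)x with x = 2y and ρ = 1/2.
  have h := hreg.exists_derivs (2 * y) hx (1 / 2) (by norm_num) k hk
  have hy2 : 2 * y + (-(2 * y)) * (1 / 2) = y := by ring
  set x := 2 * y with hxdef
  have h1 := iteratedDeriv_log_pMinus_eventuallyEq hp hx (show (1 / 2 : ℝ) < 1 by norm_num) k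
  have h2 := h1.differentiableAt_iff.1 h
  have h3 : DifferentiableAt ℝ (fun z => (((-x) ^ k)⁻¹ * ((-x) ^ k *
      ((if k = 0 then Real.log x⁻¹ else 0) +
        iteratedDeriv k (logDensity p) (x + (-x) * (1 - z / x)))))
        - (if k = 0 then Real.log x⁻¹ else 0)) y := by
    refine DifferentiableAt.sub_const (DifferentiableAt.const_mul ?_ _) _
    have hz : (1 : ℝ) - y / x = 1 / 2 := by rw [hxdef]; field_simp; norm_num
    have h4 : DifferentiableAt ℝ (fun z : ℝ => 1 - z / x) y := by fun_prop
    exact DifferentiableAt.comp y (g := fun r => (-x) ^ k * ((if k = 0 then Real.log x⁻¹ else 0) +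
        iteratedDeriv k (logDensity p) (x + (-x) * r))) (by rw [hz]; exact h2) h4
  convert h3 using 2 with z
  have hz : x + (-x) * (1 - z / x) = z := by field_simp; ring
  rw [hz, inv_mul_cancel_left₀ (pow_ne_zero _ (neg_ne_zero.2 hx.ne'))]
  ring

theorem hasDerivAt_logDensity (hp : IsDelayDensity p) (hreg : RegularityConditions p)
    {y : ℝ} (hy : 0 < y) {k : ℕ} (hk : k < 3) :
    HasDerivAt (iteratedDeriv k (logDensity p)) (iteratedDeriv (k + 1) (logDensity p) y) y := by
  rw [iteratedDeriv_succ]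
  exact (differentiableAt_iteratedDeriv_logDensity hp hreg hy hk).hasDerivAt

/-- `g = y p(y)` satisfies `g' = g h'` with `h = log g`. -/
theorem hasDerivAt_logScaleDensity (hp : IsDelayDensity p) (hreg : RegularityConditions p)
    {y : ℝ} (hy : 0 < y) :
    HasDerivAt (logScaleDensity p) (logScaleDensity p y * iteratedDeriv 1 (logDensity p) y) y := by
  have h := (hasDerivAt_logDensity hp hreg hy (k := 0) (by norm_num)).exp
  rw [iteratedDeriv_zero] at h
  have : (fun y => Real.exp (logDensity p y)) =ᶠ[𝓝 y] logScaleDensity p := by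
    filter_upwards [lt_mem_nhds hy] with z hz
    rw [logDensity, Real.exp_log (hp.logScaleDensity_pos hz)]
  rw [logDensity, Real.exp_log (hp.logScaleDensity_pos hy)] at h
  exact h.congr_of_eventuallyEq this.symm

theorem deriv_logScaleDensity_eventuallyEq (hp : IsDelayDensity p) (hreg : RegularityConditions p)
    {y : ℝ} (hy : 0 < y) :
    deriv (logScaleDensity p) =ᶠ[𝓝 y]
      fun y => logScaleDensity p y * iteratedDeriv 1 (logDensity p) y := by
  filter_upwards [lt_mem_nhds hy] with z hz
  exact (hasDerivAt_logScaleDensity hp hreg hz).deriv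

theorem hasDerivAt_deriv_logScaleDensity (hp : IsDelayDensity p) (hreg : RegularityConditions p)
    {y : ℝ} (hy : 0 < y) :
    HasDerivAt (deriv (logScaleDensity p)) (logScaleDensity p y *
      (iteratedDeriv 1 (logDensity p) y ^ 2 + iteratedDeriv 2 (logDensity p) y)) y := by
  have h := (hasDerivAt_logScaleDensity hp hreg hy).mul
    (hasDerivAt_logDensity hp hreg hy (k := 1) (by norm_num))
  refine (h.congr_of_eventuallyEq (deriv_logScaleDensity_eventuallyEq hp hreg hy)).congr_deriv ?_
  norm_num
  ring

theorem iteratedDeriv_two_logScaleDensity_eq (hp : IsDelayDensity p)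
    (hreg : RegularityConditions p) {y : ℝ} (hy : 0 < y) :
    iteratedDeriv 2 (logScaleDensity p) y = logScaleDensity p y *
      (iteratedDeriv 1 (logDensity p) y ^ 2 + iteratedDeriv 2 (logDensity p) y) := by
  rw [iteratedDeriv_succ, iteratedDeriv_one]
  exact (hasDerivAt_deriv_logScaleDensity hp hreg hy).deriv

/-- In g'' = g(h'² + h'') the factor h'' is continuous because h has a third derivative. This
carries the bound `G` to ρ = 0. -/
theorem continuousAt_iteratedDeriv_logScaleDensity (hp : IsDelayDensity p)
    (hreg : RegularityConditions p) {y : ℝ} (hy : 0 < y) :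
    ContinuousAt (iteratedDeriv 2 (logScaleDensity p)) y := by
  have h0 : ∀ k < 3, ContinuousAt (iteratedDeriv k (logDensity p)) y := fun k hk =>
    (hasDerivAt_logDensity hp hreg hy hk).continuousAt
  have h : ContinuousAt (fun y => logScaleDensity p y *
      (iteratedDeriv 1 (logDensity p) y ^ 2 + iteratedDeriv 2 (logDensity p) y)) y :=
    (hasDerivAt_logScaleDensity hp hreg hy).continuousAt.mul
      (((h0 1 (by norm_num)).pow 2).add (h0 2 (by norm_num)))
  refine h.congr ?_
  filter_upwards [lt_mem_nhds hy] with z hz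
  exact (iteratedDeriv_two_logScaleDensity_eq hp hreg hz).symm

/-- The logarithmic derivative of `p` in terms of that of `y p(y)`. -/
theorem deriv_log_density (hp : IsDelayDensity p) (hreg : RegularityConditions p)
    {y : ℝ} (hy : 0 < y) :
    deriv (fun y => Real.log (p y)) y = iteratedDeriv 1 (logDensity p) y - y⁻¹ := by
  have h := (hasDerivAt_logDensity hp hreg hy (k := 0) (by norm_num)).sub
    (Real.hasDerivAt_log hy.ne')
  refine (h.congr_of_eventuallyEq ?_).deriv
  filter_upwards [lt_mem_nhds hy] with z hz
  simp [logDensity, logScaleDensity, Real.log_mul hz.ne' (hp.pos z hz).ne']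

/-- The `ρ`-derivative of `p⁻` at `ρ = 0`. -/
theorem deriv_pMinus_zero (hp : IsDelayDensity p) (hreg : RegularityConditions p)
    {x : ℝ} (hx : 0 < x) :
    deriv (fun r => pMinus p x r) 0 = -(logScaleDensity p x * iteratedDeriv 1 (logDensity p) x) := by
  rw [deriv_pMinus p hx.ne', (hasDerivAt_logScaleDensity hp hreg (by simpa)).deriv]
  simp

end

/-! ### Finiteness and positivity of the Fisher information -/

section

theorem nonneg_of_hasDerivAt_nonneg {f f' : ℝ → ℝ} {d : ℝ}
    (hf : ∀ t ∈ Icc 0 d, HasDerivAt f (f' t) t) (h0 : 0 ≤ f 0)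
    (hf' : ∀ t ∈ Ioo 0 d, 0 ≤ f' t) : ∀ t ∈ Icc 0 d, 0 ≤ f t := by
  intro t ht
  have hmono : MonotoneOn f (Icc 0 d) := by
    refine monotoneOn_of_deriv_nonneg (convex_Icc 0 d)
      (fun t ht => (hf t ht).continuousAt.continuousWithinAt)
      (fun t ht => (hf t (interior_subset ht)).differentiableAt.differentiableWithinAt) ?_
    intro t ht
    rw [(hf t (interior_subset ht)).deriv]
    rw [interior_Icc] at ht
    exact hf' t ht
  exact h0.trans (hmono ⟨le_rfl, ht.1.trans ht.2⟩ ht ht.1)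

/-- Obtained by integrating the sign of the remainder twice. The bound on the highest derivative is
asked only in the open interval, since the domination hypotheses say nothing at ρ = 0. -/
theorem le_taylor_two {f f' f'' : ℝ → ℝ} {d M : ℝ}
    (hf : ∀ t ∈ Icc 0 d, HasDerivAt f (f' t) t)
    (hf' : ∀ t ∈ Icc 0 d, HasDerivAt f' (f'' t) t)
    (hM : ∀ t ∈ Ioo 0 d, f'' t ≤ M) {t : ℝ} (ht : t ∈ Icc 0 d) :
    f t ≤ f 0 + t * f' 0 + M * t ^ 2 / 2 := by
  have h1 := nonneg_of_hasDerivAt_nonneg (f := fun t => f' 0 + M * t - f' t)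
    (f' := fun t => M - f'' t) (d := d)
    (fun t ht => by
      have := (((hasDerivAt_id t).const_mul M).const_add (f' 0)).sub (hf' t ht)
      exact this.congr_deriv (by ring))
    (by simp) (fun t ht => by linarith [hM t ht])
  have h2 := nonneg_of_hasDerivAt_nonneg (f := fun t => f 0 + f' 0 * t + M / 2 * t ^ 2 - f t)
    (f' := fun t => f' 0 + M * t - f' t) (d := d)
    (fun t ht => by
      have := ((((hasDerivAt_id t).const_mul (f' 0)).const_add (f 0)).add
        (((hasDerivAt_id t).pow 2).const_mul (M / 2))).sub (hf t ht)
      refine this.congr_deriv ?_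
      simp; ring)
    (by simp) (fun t ht => h1 t ⟨ht.1.le, ht.2.le⟩) t ht
  linarith

theorem taylor_three_le {f f' f'' f''' : ℝ → ℝ} {d M : ℝ}
    (hf : ∀ t ∈ Icc 0 d, HasDerivAt f (f' t) t)
    (hf' : ∀ t ∈ Icc 0 d, HasDerivAt f' (f'' t) t)
    (hf'' : ∀ t ∈ Icc 0 d, HasDerivAt f'' (f''' t) t)
    (hM : ∀ t ∈ Ioo 0 d, -M ≤ f''' t) {t : ℝ} (ht : t ∈ Icc 0 d) :
    f 0 + t * f' 0 + t ^ 2 / 2 * f'' 0 - t ^ 3 / 6 * M ≤ f t := by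
  have h1 := nonneg_of_hasDerivAt_nonneg (f := fun t => f'' t - f'' 0 + M * t)
    (f' := fun t => f''' t + M) (d := d)
    (fun t ht => by
      have := ((hf'' t ht).sub_const (f'' 0)).add ((hasDerivAt_id t).const_mul M)
      exact this.congr_deriv (by ring))
    (by simp) (fun t ht => by linarith [hM t ht])
  have h2 := nonneg_of_hasDerivAt_nonneg
    (f := fun t => f' t - f' 0 - f'' 0 * t + M / 2 * t ^ 2)
    (f' := fun t => f'' t - f'' 0 + M * t) (d := d)
    (fun t ht => by
      have := (((hf' t ht).sub_const (f' 0)).sub ((hasDerivAt_id t).const_mul (f'' 0))).add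
        (((hasDerivAt_id t).pow 2).const_mul (M / 2))
      refine this.congr_deriv ?_
      simp; ring)
    (by simp) (fun t ht => h1 t ⟨ht.1.le, ht.2.le⟩)
  have h3 := nonneg_of_hasDerivAt_nonneg
    (f := fun t => f t - f 0 - f' 0 * t - f'' 0 / 2 * t ^ 2 + M / 6 * t ^ 3)
    (f' := fun t => f' t - f' 0 - f'' 0 * t + M / 2 * t ^ 2) (d := d)
    (fun t ht => by
      have := ((((hf t ht).sub_const (f 0)).sub ((hasDerivAt_id t).const_mul (f' 0))).sub
        (((hasDerivAt_id t).pow 2).const_mul (f'' 0 / 2))).add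
        (((hasDerivAt_id t).pow 3).const_mul (M / 6))
      refine this.congr_deriv ?_
      simp; ring)
    (by simp) (fun t ht => h2 t ⟨ht.1.le, ht.2.le⟩) t ht
  linarith

/-- A positive function with bounded second derivative has a small derivative where it is small. -/
theorem sq_le_of_forall_nonneg {q a M d : ℝ} (ha : 0 < a) (hd : 0 < d) (hM : 0 ≤ M)
    (h : ∀ t ∈ Icc 0 d, 0 ≤ q + t * (-a) + M * t ^ 2 / 2) : a ^ 2 ≤ 2 * q * (M + a / d) := by
  have hD : 0 < M + a / d := by positivity
  -- Near the minimiser a/M of the quadratic, but with denominator enlarged so that t ≤ d and M = 0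
  -- is allowed.
  set t := a / (M + a / d) with ht
  have htd : t ≤ d := by
    rw [ht, div_le_iff₀ hD, mul_add, mul_div_cancel₀ _ hd.ne']
    nlinarith
  have ht0 : 0 < t := by positivity
  have hta : M * t ≤ a := by
    rw [ht, mul_div_assoc', div_le_iff₀ hD]
    have : 0 ≤ a * (a / d) := by positivity
    nlinarith
  have h1 := h t ⟨ht0.le, htd⟩
  have h2 : t * a / 2 ≤ q := by nlinarith
  have h3 : t * (M + a / d) = a := by rw [ht, div_mul_cancel₀ _ hD.ne']
  calc a ^ 2 = (t * a / 2) * (2 * (M + a / d)) := by linear_combination (-a) * h3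
    _ ≤ q * (2 * (M + a / d)) := by gcongr
    _ = _ := by ring

variable {p : ℝ → ℝ}

theorem hasDerivAt_pMinus (hp : IsDelayDensity p) (hreg : RegularityConditions p) {x r : ℝ}
    (hx : 0 < x) (hr : r < 1) :
    HasDerivAt (fun r => pMinus p x r) (deriv (fun r => pMinus p x r) r) r := by
  refine DifferentiableAt.hasDerivAt ?_
  have : (fun r => pMinus p x r) = fun r => x⁻¹ * logScaleDensity p (x + (-x) * r) :=
    funext fun r => pMinus_eq p hx.ne' r
  rw [this]
  have h := (hasDerivAt_logScaleDensity hp hreg (add_neg_mul_pos hx hr)).differentiableAt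
  exact (h.comp r (f := fun r => x + (-x) * r) (by fun_prop)).const_mul _

theorem hasDerivAt_deriv_pMinus (hp : IsDelayDensity p) (hreg : RegularityConditions p) {x r : ℝ}
    (hx : 0 < x) (hr : r < 1) :
    HasDerivAt (deriv (fun r => pMinus p x r)) (iteratedDeriv 2 (fun r => pMinus p x r) r) r := by
  rw [iteratedDeriv_succ, iteratedDeriv_one]
  refine DifferentiableAt.hasDerivAt ?_
  have : deriv (fun r => pMinus p x r) = fun r => - deriv (logScaleDensity p) (x + (-x) * r) :=
    funext fun r => deriv_pMinus p hx.ne' r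
  rw [this]
  have h := (hasDerivAt_deriv_logScaleDensity hp hreg (add_neg_mul_pos hx hr)).differentiableAt
  exact (h.comp r (f := fun r => x + (-x) * r) (by fun_prop)).neg

theorem continuousAt_iteratedDeriv_pMinus (hp : IsDelayDensity p) (hreg : RegularityConditions p)
    {x r : ℝ} (hx : 0 < x) (hr : r < 1) :
    ContinuousAt (iteratedDeriv 2 (fun r => pMinus p x r)) r := by
  have : iteratedDeriv 2 (fun r => pMinus p x r) = fun r =>
      x⁻¹ * ((-x) ^ 2 * iteratedDeriv 2 (logScaleDensity p) (x + (-x) * r)) :=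
    funext fun r => iteratedDeriv_pMinus p hx.ne' 2 r
  rw [this]
  have h := continuousAt_iteratedDeriv_logScaleDensity hp hreg (add_neg_mul_pos hx hr)
  exact ((h.comp (f := fun r => x + (-x) * r) (by fun_prop)).const_mul _).const_mul _

theorem iteratedDeriv_two_pMinus_zero (hp : IsDelayDensity p) (hreg : RegularityConditions p)
    {x : ℝ} (hx : 0 < x) :
    iteratedDeriv 2 (fun r => pMinus p x r) 0 =
      p x * ((x * iteratedDeriv 1 (logDensity p) x) ^ 2 +
        x ^ 2 * iteratedDeriv 2 (logDensity p) x) := by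
  rw [iteratedDeriv_pMinus p hx.ne', mul_zero, add_zero,
    iteratedDeriv_two_logScaleDensity_eq hp hreg hx, logScaleDensity]
  field_simp

/-- Extends the dominating bounds to ρ = 0, where the strict inequality weakens to `≤`. -/
theorem abs_le_of_forall_Ioo {f : ℝ → ℝ} {δ M : ℝ} (hδ : 0 < δ) (hf : ContinuousAt f 0)
    (h : ∀ r ∈ Ioo 0 δ, |f r| < M) : |f 0| ≤ M := by
  have h1 : Tendsto (fun r => |f r|) (𝓝[>] 0) (𝓝 |f 0|) :=
    (hf.abs.tendsto).mono_left nhdsWithin_le_nhds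
  refine le_of_tendsto h1 ?_
  filter_upwards [Ioo_mem_nhdsGT hδ] with r hr
  exact (h r hr).le

/-- The score of the scaling family at `ρ = 0`, up to sign. -/
noncomputable def scoreZero (p : ℝ → ℝ) (x : ℝ) : ℝ := x * iteratedDeriv 1 (logDensity p) x

/-- The second `ρ`-derivative of `log p⁻` at `ρ = 0`. -/
noncomputable def scoreDeriv (p : ℝ → ℝ) (x : ℝ) : ℝ := x ^ 2 * iteratedDeriv 2 (logDensity p) x

theorem measurable_iteratedDeriv_logDensity (k : ℕ) :
    Measurable (iteratedDeriv (k + 1) (logDensity p)) := by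
  rw [iteratedDeriv_succ]
  exact measurable_deriv _

theorem measurable_scoreZero : Measurable (scoreZero p) :=
  measurable_id.mul (measurable_iteratedDeriv_logDensity 0)

theorem measurable_scoreDeriv : Measurable (scoreDeriv p) :=
  (measurable_id.pow_const 2).mul (measurable_iteratedDeriv_logDensity 1)

theorem deriv_pMinus_zero_eq (hp : IsDelayDensity p) (hreg : RegularityConditions p)
    {x : ℝ} (hx : 0 < x) :
    deriv (fun r => pMinus p x r) 0 = -(p x * scoreZero p x) := by
  rw [deriv_pMinus_zero hp hreg hx, logScaleDensity, scoreZero]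
  ring

theorem IsDelayDensity.aestronglyMeasurable (hp : IsDelayDensity p) :
    AEStronglyMeasurable p (volume.restrict (Ioi 0)) := hp.integrable.aestronglyMeasurable

theorem integrableOn_mul_scoreZero (hp : IsDelayDensity p) (hreg : RegularityConditions p) :
    IntegrableOn (fun x => p x * scoreZero p x) (Ioi 0) := by
  obtain ⟨δ, hδ, -, F, G, H, hF, -, -, hb⟩ := hreg.dominated
  refine Integrable.mono' hF
    (hp.aestronglyMeasurable.mul measurable_scoreZero.aestronglyMeasurable) ?_
  filter_upwards [ae_restrict_mem measurableSet_Ioi] with x hx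
  rw [Real.norm_eq_abs, ← abs_neg, ← deriv_pMinus_zero_eq hp hreg hx]
  exact abs_le_of_forall_Ioo (f := deriv fun r => pMinus p x r) hδ
    (hasDerivAt_deriv_pMinus hp hreg hx one_pos).continuousAt (fun r hr => (hb r hr x hx).1)

theorem integral_mul_scoreZero (hp : IsDelayDensity p) (hreg : RegularityConditions p) :
    ∫ x in Ioi 0, p x * scoreZero p x = 0 := by
  have h := hreg.integral_deriv_zero
  rw [setIntegral_congr_fun measurableSet_Ioi
    (fun x hx => deriv_pMinus_zero_eq hp hreg hx), integral_neg] at h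
  linarith

theorem integrableOn_deriv_two (hp : IsDelayDensity p) (hreg : RegularityConditions p) :
    IntegrableOn (fun x => p x * (scoreZero p x ^ 2 + scoreDeriv p x)) (Ioi 0) := by
  obtain ⟨δ, hδ, -, F, G, H, -, hG, -, hb⟩ := hreg.dominated
  refine Integrable.mono' hG
    (hp.aestronglyMeasurable.mul
      ((measurable_scoreZero.pow_const 2).add measurable_scoreDeriv).aestronglyMeasurable) ?_
  filter_upwards [ae_restrict_mem measurableSet_Ioi] with x hx
  rw [Real.norm_eq_abs, scoreZero, scoreDeriv, ← iteratedDeriv_two_pMinus_zero hp hreg hx]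
  exact abs_le_of_forall_Ioo (f := iteratedDeriv 2 fun r => pMinus p x r) hδ
    (continuousAt_iteratedDeriv_pMinus hp hreg hx one_pos) (fun r hr => (hb r hr x hx).2.1)

theorem integral_deriv_two (hp : IsDelayDensity p) (hreg : RegularityConditions p) :
    ∫ x in Ioi 0, p x * (scoreZero p x ^ 2 + scoreDeriv p x) = 0 := by
  refine Eq.trans ?_ hreg.integral_deriv_two_zero
  exact setIntegral_congr_fun measurableSet_Ioi
    fun x hx => (iteratedDeriv_two_pMinus_zero hp hreg hx).symm

/-- The Fisher information integrand is dominated through the bound on the second derivative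
along the scaling orbit of `x`. -/
theorem mul_scoreZero_sq_le (hp : IsDelayDensity p) (hreg : RegularityConditions p) {d : ℝ}
    {G : ℝ → ℝ} (hd : 0 < d) (hd1 : d < 1)
    (hG : ∀ x, 0 < x → ∀ r ∈ Ioo 0 d, |iteratedDeriv 2 (fun r => pMinus p x r) r| < G x)
    {x : ℝ} (hx : 0 < x) :
    p x * scoreZero p x ^ 2 ≤
      2 * (G x + G ((1 - d)⁻¹ * x) + |p x * scoreZero p x| / d) := by
  have hG0 : ∀ x, 0 < x → 0 ≤ G x := fun x hx =>
    (abs_nonneg _).trans (hG x hx (d / 2) ⟨by linarith, by linarith⟩).le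
  have hpx := hp.pos x hx
  have h1d : 0 < 1 - d := by linarith
  have hx' : 0 < (1 - d)⁻¹ * x := by positivity
  suffices (p x * scoreZero p x) ^ 2 ≤
      2 * p x * (G x + G ((1 - d)⁻¹ * x) + |p x * scoreZero p x| / d) by
    refine le_of_mul_le_mul_left ?_ hpx
    linarith
  -- The quadratic inequality must be used in the direction in which p⁻ decreases. Its slope at ρ =
  -- 0 is -p s, so a negative p s would require ρ < 0, where no bound is available.
  rcases lt_trichotomy (p x * scoreZero p x) 0 with ha | ha | ha
  · have key : (-(p x * scoreZero p x)) ^ 2 ≤ 2 * ((1 - d) * p x) *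
        (G ((1 - d)⁻¹ * x) + -(p x * scoreZero p x) / d) := by
      refine sq_le_of_forall_nonneg (neg_pos.2 ha) hd (hG0 _ hx') ?_
      intro t ht
      -- On the orbit of x' = x/(1 - d) the point x is reached at ρ = d, so one can go backwards
      -- from d to 0 inside the range where `G` is valid.
      set x' := (1 - d)⁻¹ * x with hx'def
      have hxx : (1 - d) * x' = x := by rw [hx'def]; field_simp
      have h := le_taylor_two (f := fun t => pMinus p x' (d - t))
        (f' := fun t => - deriv (fun r => pMinus p x' r) (d - t))
        (f'' := fun t => iteratedDeriv 2 (fun r => pMinus p x' r) (d - t)) (d := d)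
        (M := G x')
        (fun t ht => by
          have := (hasDerivAt_pMinus hp hreg hx' (show d - t < 1 by linarith [ht.1])).comp t
            ((hasDerivAt_id t).const_sub d)
          exact this.congr_deriv (by ring))
        (fun t ht => by
          have := ((hasDerivAt_deriv_pMinus hp hreg hx'
            (show d - t < 1 by linarith [ht.1])).comp t ((hasDerivAt_id t).const_sub d)).neg
          exact this.congr_deriv (by ring))
        (fun t ht => (le_abs_self _).trans
          (hG x' hx' (d - t) ⟨by linarith [ht.2], by linarith [ht.1]⟩).le) ht
      have hpos := hp.pMinus_pos hx' (show d - t < 1 by linarith [ht.1])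
      have e1 : pMinus p x' (d - 0) = (1 - d) * p x := by rw [pMinus, sub_zero, hxx]
      have e2 : deriv (fun r => pMinus p x' r) (d - 0) = -(p x * scoreZero p x) := by
        rw [deriv_pMinus p hx'.ne', ← deriv_pMinus_zero_eq hp hreg hx, deriv_pMinus p hx.ne']
        congr 2
        rw [← hxx]; ring
      simp only [e1, e2] at h
      linarith
    rw [neg_sq] at key
    refine key.trans ?_
    rw [abs_of_neg ha]
    have := hG0 x hx
    have h3 : 0 < -(p x * scoreZero p x) / d := div_pos (neg_pos.2 ha) hd
    have h4 := hG0 _ hx'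
    gcongr
    · nlinarith
    · linarith
  · have := hG0 x hx
    have h4 := hG0 _ hx'
    rw [ha]
    simp only [ne_eq, OfNat.ofNat_ne_zero, not_false_eq_true, zero_pow, abs_zero, zero_div]
    positivity
  · have key : (p x * scoreZero p x) ^ 2 ≤ 2 * p x *
        (G x + (p x * scoreZero p x) / d) := by
      refine sq_le_of_forall_nonneg ha hd (hG0 _ hx) ?_
      intro t ht
      have h := le_taylor_two (f := fun t => pMinus p x t)
        (f' := deriv (fun r => pMinus p x r))
        (f'' := iteratedDeriv 2 (fun r => pMinus p x r)) (d := d)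
        (M := G x)
        (fun t ht => hasDerivAt_pMinus hp hreg hx (show t < 1 by linarith [ht.2]))
        (fun t ht => hasDerivAt_deriv_pMinus hp hreg hx (show t < 1 by linarith [ht.2]))
        (fun t ht => (le_abs_self _).trans (hG x hx t ht).le) ht
      have hpos := hp.pMinus_pos hx (show t < 1 by linarith [ht.2])
      have e1 : pMinus p x 0 = p x := by simp [pMinus]
      simp only [e1, deriv_pMinus_zero_eq hp hreg hx] at h
      linarith
    refine key.trans ?_
    rw [abs_of_pos ha]
    have h4 := hG0 _ hx'
    gcongr
    linarith

theorem integrableOn_mul_scoreZero_sq (hp : IsDelayDensity p) (hreg : RegularityConditions p) :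
    IntegrableOn (fun x => p x * scoreZero p x ^ 2) (Ioi 0) := by
  obtain ⟨δ, hδ, hδ1, F, G, H, -, hG, -, hb⟩ := hreg.dominated
  -- Halving δ keeps 1 - d positive even when δ = 1.
  have hd : 0 < δ / 2 := by linarith
  have hd1 : δ / 2 < 1 := by linarith
  have hG' : IntegrableOn (fun x => G ((1 - δ / 2)⁻¹ * x)) (Ioi 0) := by
    rw [integrableOn_Ioi_comp_mul_left_iff G 0 (inv_pos.2 (by linarith)), mul_zero]
    exact hG
  refine Integrable.mono' (((hG.add hG').add
    ((integrableOn_mul_scoreZero hp hreg).abs.div_const (δ / 2))).const_mul 2)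
    (hp.aestronglyMeasurable.mul (measurable_scoreZero.pow_const 2).aestronglyMeasurable) ?_
  filter_upwards [ae_restrict_mem measurableSet_Ioi] with x hx
  have hpx := hp.pos x hx
  rw [Real.norm_eq_abs, abs_of_nonneg (by positivity)]
  exact mul_scoreZero_sq_le hp hreg hd hd1
    (fun x hx r hr => (hb r ⟨hr.1, by linarith [hr.2]⟩ x hx).2.1) hx

/-- The Fisher information of the scaling family at `ρ = 0`. -/
noncomputable def fisherInfo (p : ℝ → ℝ) : ℝ := ∫ x in Ioi 0, p x * scoreZero p x ^ 2

theorem integrableOn_mul_scoreDeriv (hp : IsDelayDensity p) (hreg : RegularityConditions p) :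
    IntegrableOn (fun x => p x * scoreDeriv p x) (Ioi 0) := by
  refine ((integrableOn_deriv_two hp hreg).sub (integrableOn_mul_scoreZero_sq hp hreg)).congr ?_
  filter_upwards with x
  simp only [Pi.sub_apply]
  ring

theorem integral_mul_scoreDeriv (hp : IsDelayDensity p) (hreg : RegularityConditions p) :
    ∫ x in Ioi 0, p x * scoreDeriv p x = - fisherInfo p := by
  have h := integral_deriv_two hp hreg
  simp only [mul_add] at h
  rw [integral_add (integrableOn_mul_scoreZero_sq hp hreg)
    (integrableOn_mul_scoreDeriv hp hreg)] at h
  rw [fisherInfo]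
  linarith

theorem mul_sq_deriv_log (hp : IsDelayDensity p) (hreg : RegularityConditions p)
    {x : ℝ} (hx : 0 < x) :
    p x * x ^ 2 * (deriv (fun y => Real.log (p y)) x) ^ 2 =
      p x * scoreZero p x ^ 2 - 2 * (p x * scoreZero p x) + p x := by
  rw [deriv_log_density hp hreg hx, scoreZero]
  field_simp
  ring

theorem sq_deriv_pMinus_div (hp : IsDelayDensity p) (hreg : RegularityConditions p)
    {x : ℝ} (hx : 0 < x) :
    (deriv (fun r => pMinus p x r) 0) ^ 2 / p x = p x * scoreZero p x ^ 2 := by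
  rw [deriv_pMinus_zero_eq hp hreg hx]
  have := (hp.pos x hx).ne'
  field_simp

theorem integrableOn_mul_sq_deriv_log (hp : IsDelayDensity p) (hreg : RegularityConditions p) :
    IntegrableOn (fun x => p x * x ^ 2 * (deriv (fun y => Real.log (p y)) x) ^ 2) (Ioi 0) :=
  (((integrableOn_mul_scoreZero_sq hp hreg).sub
    ((integrableOn_mul_scoreZero hp hreg).const_mul 2)).add hp.integrable).congr
    ((ae_restrict_mem measurableSet_Ioi).mono fun _ hx => (mul_sq_deriv_log hp hreg hx).symm)

theorem integrableOn_sq_deriv_pMinus_div (hp : IsDelayDensity p)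
    (hreg : RegularityConditions p) :
    IntegrableOn (fun x => (deriv (fun r => pMinus p x r) 0) ^ 2 / p x) (Ioi 0) :=
  (integrableOn_mul_scoreZero_sq hp hreg).congr
    ((ae_restrict_mem measurableSet_Ioi).mono fun _ hx => (sq_deriv_pMinus_div hp hreg hx).symm)

theorem integral_sq_deriv_pMinus_div (hp : IsDelayDensity p) (hreg : RegularityConditions p) :
    ∫ x in Ioi 0, (deriv (fun r => pMinus p x r) 0) ^ 2 / p x = fisherInfo p :=
  setIntegral_congr_fun measurableSet_Ioi fun _ hx => sq_deriv_pMinus_div hp hreg hx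

theorem bufferConst_eq (hp : IsDelayDensity p) (hreg : RegularityConditions p) :
    bufferConst p = fisherInfo p := by
  have h1 := integrableOn_mul_scoreZero_sq hp hreg
  have h2 := (integrableOn_mul_scoreZero hp hreg).const_mul 2
  have h3 : IntegrableOn (fun x => p x * scoreZero p x ^ 2 - 2 * (p x * scoreZero p x)) (Ioi 0) :=
    h1.sub h2
  rw [bufferConst, setIntegral_congr_fun measurableSet_Ioi
    (fun x hx => mul_sq_deriv_log hp hreg hx), integral_add h3 hp.integrable,
    integral_sub h1 h2, integral_const_mul, integral_mul_scoreZero hp hreg, hp.integral_eq_one,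
    fisherInfo]
  ring

theorem fisherInfo_pos (hp : IsDelayDensity p) (hreg : RegularityConditions p) :
    0 < fisherInfo p := by
  have hnn : 0 ≤ᵐ[volume.restrict (Ioi 0)] fun x => p x * scoreZero p x ^ 2 := by
    filter_upwards [ae_restrict_mem measurableSet_Ioi] with x hx
    have := hp.pos x hx
    simp only [Pi.zero_apply]
    positivity
  refine lt_of_le_of_ne (integral_nonneg_of_ae hnn) fun h0 => ?_
  have hae := (integral_eq_zero_iff_of_nonneg_ae hnn (integrableOn_mul_scoreZero_sq hp hreg)).1
    h0.symm
  have hcont : ContinuousOn (scoreZero p) (Ioi 0) := fun x hx =>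
    (continuousAt_id.mul (hasDerivAt_logDensity hp hreg (k := 1) hx
      (by norm_num)).continuousAt).continuousWithinAt
  -- Continuity upgrades almost everywhere to everywhere; then g' = 0, so x p(x) is constant and p
  -- is a multiple of 1/x.
  have hzero : EqOn (scoreZero p) 0 (Ioi 0) := by
    refine Measure.eqOn_open_of_ae_eq (μ := volume) ?_ isOpen_Ioi hcont continuousOn_const
    filter_upwards [hae, ae_restrict_mem measurableSet_Ioi] with x h hx
    have h' : p x * scoreZero p x ^ 2 = 0 := h
    simpa [(hp.pos x hx).ne'] using h'
  have hd : ∀ x ∈ Ioi (0 : ℝ), HasDerivAt (logScaleDensity p) 0 x := by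
    intro x hx
    have h := hasDerivAt_logScaleDensity hp hreg hx
    have hz : x * iteratedDeriv 1 (logDensity p) x = 0 := hzero hx
    have hx0 : x ≠ 0 := ne_of_gt hx
    rw [(mul_eq_zero.1 hz).resolve_left hx0, mul_zero] at h
    exact h
  have hconst : ∀ x ∈ Ioi (0 : ℝ), logScaleDensity p x = p 1 := by
    intro x hx
    have := isOpen_Ioi.is_const_of_deriv_eq_zero (𝕜 := ℝ) (s := Ioi (0:ℝ)) isPreconnected_Ioi
      (fun x hx => (hd x hx).differentiableAt.differentiableWithinAt)
      (fun x hx => (hd x hx).deriv) hx (show (1 : ℝ) ∈ Ioi 0 by simp)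
    rw [this, logScaleDensity, one_mul]
  have hint : IntegrableOn (fun x : ℝ => x⁻¹) (Ioi 0) := by
    refine (hp.integrable.div_const (p 1)).congr ?_
    filter_upwards [ae_restrict_mem measurableSet_Ioi] with x hx
    have hx0 : x ≠ 0 := ne_of_gt hx
    rw [← hconst x hx, logScaleDensity]
    have := (hp.pos x hx).ne'
    field_simp
  exact not_integrableOn_Ioi_inv hint

end

/-! ### Hellinger affinity: testing bound and second-order estimate -/

section

section Product

variable {X : Type*} [MeasurableSpace X] {P : Measure X} [IsProbabilityMeasure P]

theorem pi_withDensity_ofReal {ι : Type*} [Fintype ι] {w : X → ℝ} (hw : Integrable w P)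
    (hw0 : ∀ x, 0 ≤ w x) [SigmaFinite (P.withDensity fun x => ENNReal.ofReal (w x))] :
    Measure.pi (fun _ : ι => P.withDensity fun x => ENNReal.ofReal (w x)) =
      (Measure.pi fun _ : ι => P).withDensity fun x => ENNReal.ofReal (∏ i, w (x i)) := by
  refine Measure.pi_eq fun s hs => ?_
  rw [withDensity_apply _ (MeasurableSet.univ_pi hs), Measure.restrict_pi_pi,
    ← ofReal_integral_eq_lintegral_ofReal
      (Integrable.fintype_prod (f := fun _ => w) fun i => hw.restrict)
      (ae_of_all _ fun x => Finset.prod_nonneg fun i _ => hw0 _),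
    integral_fintype_prod_eq_prod (fun _ => w),
    ENNReal.ofReal_prod_of_nonneg fun i _ => integral_nonneg hw0]
  refine Finset.prod_congr rfl fun i _ => ?_
  rw [withDensity_apply _ (hs i), ofReal_integral_eq_lintegral_ofReal hw.restrict
    (ae_of_all _ hw0)]

/-- If two laws have a large Hellinger affinity, no test separates them well. -/
theorem one_sub_le_of_affinity {V : X → ℝ} (hV : Integrable V P)
    (hV2 : Integrable (fun x => V x ^ 2) P) (h1 : ∫ x, V x ^ 2 ∂P = 1) {R : Set X}
    (hR : MeasurableSet R) {ε : ℝ} (hε : 0 < ε) (haff : 1 - ε ^ 2 / 2 < ∫ x, V x ∂P) :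
    1 - ε ≤ P.real R + ∫ x in Rᶜ, V x ^ 2 ∂P := by
  -- A weighted AM-GM in place of Cauchy–Schwarz, so that the rest is linear in the two error
  -- probabilities.
  have key : ∀ t : ℝ, 0 < t → ∀ v : ℝ, v ≤ t / 2 + v ^ 2 * (t⁻¹ / 2) := by
    intro t ht v
    have : t / 2 + v ^ 2 * (t⁻¹ / 2) - v = (t - v) ^ 2 / (2 * t) := by field_simp; ring
    have h2 : 0 ≤ (t - v) ^ 2 / (2 * t) := by positivity
    linarith
  have hsplit := integral_add_compl hR hV
  have hsplit2 := integral_add_compl hR hV2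
  have hPR : P.real Rᶜ = 1 - P.real R := probReal_compl_eq_one_sub hR
  have hb : ∀ (S : Set X) (t : ℝ), 0 < t →
      ∫ x in S, V x ∂P ≤ P.real S * (t / 2) + (∫ x in S, V x ^ 2 ∂P) * (t⁻¹ / 2) := by
    intro S t ht
    have h3 : Integrable (fun x => t / 2 + V x ^ 2 * (t⁻¹ / 2)) (P.restrict S) :=
      (integrable_const _).add (hV2.restrict.mul_const _)
    refine (integral_mono hV.restrict h3 fun x => key t ht (V x)).trans ?_
    rw [integral_add (integrable_const _) (hV2.restrict.mul_const _), integral_mul_const]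
    simp [measureReal_def]
  have ht : 0 < 1 + ε := by linarith
  -- With weights 1 + ε on `R` and u = 1/(1 + ε) off it, the affinity is at most u + (1 + ε - u)(m +
  -- q)/2. At m + q = 1 - ε this is exactly 1 - ε²/2.
  have hbR := hb R (1 + ε) ht
  have hbC := hb Rᶜ (1 + ε)⁻¹ (inv_pos.2 ht)
  rw [inv_inv, hPR] at hbC
  by_contra! hlt
  set m := P.real R
  set q := ∫ x in Rᶜ, V x ^ 2 ∂P
  have hR2 : ∫ x in R, V x ^ 2 ∂P = 1 - q := by linarith
  rw [hR2] at hbR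
  have hinv : (1 + ε) * (1 + ε)⁻¹ = 1 := mul_inv_cancel₀ ht.ne'
  set u := (1 + ε)⁻¹
  have hu1 : u < 1 + ε := by
    have hu : 0 < u := inv_pos.2 ht
    nlinarith
  have h4 : (1 + ε - u) * (m + q) ≤ (1 + ε - u) * (1 - ε) :=
    mul_le_mul_of_nonneg_left hlt.le (by linarith)
  nlinarith

end Product

section Law

variable {p : ℝ → ℝ}

theorem aemeasurable_ofReal_density (hp : IsDelayDensity p) :
    AEMeasurable (fun x => ENNReal.ofReal (p x)) (volume.restrict (Ioi 0)) :=
  hp.aestronglyMeasurable.aemeasurable.ennreal_ofReal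

theorem toReal_ofReal_density_mul (hp : IsDelayDensity p) (f : ℝ → ℝ) :
    (fun x => (ENNReal.ofReal (p x)).toReal • f x) =ᵐ[volume.restrict (Ioi 0)]
      fun x => p x * f x := by
  filter_upwards [ae_restrict_mem measurableSet_Ioi] with x hx
  rw [ENNReal.toReal_ofReal (hp.pos x hx).le, smul_eq_mul]

theorem integral_delayLaw (hp : IsDelayDensity p) (f : ℝ → ℝ) :
    ∫ x, f x ∂delayLaw p = ∫ x in Ioi 0, p x * f x := by
  rw [delayLaw, integral_withDensity_eq_integral_toReal_smul₀ (aemeasurable_ofReal_density hp)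
    (ae_of_all _ fun _ => ENNReal.ofReal_lt_top)]
  exact integral_congr_ae (toReal_ofReal_density_mul hp f)

theorem integrable_delayLaw_iff (hp : IsDelayDensity p) (f : ℝ → ℝ) :
    Integrable f (delayLaw p) ↔ IntegrableOn (fun x => p x * f x) (Ioi 0) := by
  rw [delayLaw, integrable_withDensity_iff_integrable_smul₀' (aemeasurable_ofReal_density hp)
    (ae_of_all _ fun _ => ENNReal.ofReal_lt_top)]
  exact integrable_congr (toReal_ofReal_density_mul hp f)

theorem isProbabilityMeasure_delayLaw (hp : IsDelayDensity p) :
    IsProbabilityMeasure (delayLaw p) := by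
  constructor
  rw [delayLaw, withDensity_apply _ MeasurableSet.univ, Measure.restrict_univ,
    ← ofReal_integral_eq_lintegral_ofReal hp.integrable
      ((ae_restrict_mem measurableSet_Ioi).mono fun x hx => (hp.pos x hx).le),
    hp.integral_eq_one, ENNReal.ofReal_one]

theorem ae_delayLaw_pos : ∀ᵐ x ∂delayLaw p, 0 < x :=
  (withDensity_absolutelyContinuous _ _).ae_le (ae_restrict_mem measurableSet_Ioi)

/-- The square root of the likelihood ratio between the stretched and the original delay law. -/
noncomputable def sqrtRatio (p : ℝ → ℝ) (ρ x : ℝ) : ℝ :=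
  Real.exp ((Real.log (pMinus p x ρ) - Real.log (p x)) / 2)

theorem sqrtRatio_pos (ρ x : ℝ) : 0 < sqrtRatio p ρ x := Real.exp_pos _

theorem mul_sqrtRatio_sq (hp : IsDelayDensity p) {ρ x : ℝ} (hρ : ρ < 1) (hx : 0 < x) :
    p x * sqrtRatio p ρ x ^ 2 = pMinus p x ρ := by
  rw [sqrtRatio, ← Real.exp_nat_mul, Nat.cast_ofNat, mul_div_cancel₀ _ two_ne_zero, Real.exp_sub,
    Real.exp_log (hp.pMinus_pos hx hρ), Real.exp_log (hp.pos x hx),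
    mul_div_cancel₀ _ (hp.pos x hx).ne']

theorem integrableOn_pMinus (hp : IsDelayDensity p) {ρ : ℝ} (hρ : ρ < 1) :
    IntegrableOn (fun x => pMinus p x ρ) (Ioi 0) := by
  refine Integrable.const_mul ?_ _
  have := (integrableOn_Ioi_comp_mul_left_iff p 0 (show 0 < 1 - ρ by linarith)).2
    (by rw [mul_zero]; exact hp.integrable)
  exact this

theorem integrable_sqrtRatio_sq (hp : IsDelayDensity p) {ρ : ℝ} (hρ : ρ < 1) :
    Integrable (fun x => sqrtRatio p ρ x ^ 2) (delayLaw p) := by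
  rw [integrable_delayLaw_iff hp]
  exact (integrableOn_pMinus hp hρ).congr ((ae_restrict_mem measurableSet_Ioi).mono
    fun x hx => (mul_sqrtRatio_sq hp hρ hx).symm)

/-- Measurability of `p` is known only through integrability, so that of the ratio is recovered from
its integrable square. -/
theorem aestronglyMeasurable_sqrtRatio (hp : IsDelayDensity p) {ρ : ℝ} (hρ : ρ < 1) :
    AEStronglyMeasurable (sqrtRatio p ρ) (delayLaw p) := by
  have h := (integrable_sqrtRatio_sq hp hρ).aestronglyMeasurable.aemeasurable.sqrt
  refine h.aestronglyMeasurable.congr (ae_of_all _ fun x => ?_)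
  exact Real.sqrt_sq (sqrtRatio_pos ρ x).le

theorem integrable_sqrtRatio (hp : IsDelayDensity p) {ρ : ℝ} (hρ : ρ < 1) :
    Integrable (sqrtRatio p ρ) (delayLaw p) := by
  have := isProbabilityMeasure_delayLaw hp
  refine Integrable.mono' ((integrable_const 1).add (integrable_sqrtRatio_sq hp hρ))
    (aestronglyMeasurable_sqrtRatio hp hρ) (ae_of_all _ fun x => ?_)
  have := sqrtRatio_pos (p := p) ρ x
  rw [Real.norm_eq_abs, abs_of_pos this, Pi.add_apply]
  nlinarith [sq_nonneg (sqrtRatio p ρ x - 1)]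

/-- The stretched delays have the scaled density. -/
theorem map_div_delayLaw (hp : IsDelayDensity p) {ρ : ℝ} (hρ : ρ < 1) :
    (delayLaw p).map (fun x => x / (1 - ρ)) =
      (delayLaw p).withDensity fun x => ENNReal.ofReal (sqrtRatio p ρ x ^ 2) := by
  have := isProbabilityMeasure_delayLaw hp
  have hb : 0 < 1 - ρ := by linarith
  ext s hs
  have hm : Measurable fun x : ℝ => x / (1 - ρ) := by fun_prop
  have hs' := hm hs
  rw [Measure.map_apply hm hs, withDensity_apply _ hs,
    ← ofReal_integral_eq_lintegral_ofReal (integrable_sqrtRatio_sq hp hρ).restrict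
      (ae_of_all _ fun x => sq_nonneg _), ← ofReal_measureReal, ← integral_indicator_one hs',
    ← integral_indicator hs, integral_delayLaw hp, integral_delayLaw hp]
  congr 1
  have h := integral_comp_mul_left_Ioi
    (fun y => p y * ((fun x => x / (1 - ρ)) ⁻¹' s).indicator (1 : ℝ → ℝ) y) 0 hb
  rw [mul_zero] at h
  have h2 := congrArg (fun z => (1 - ρ) * z) h
  simp only [smul_eq_mul, mul_inv_cancel_left₀ hb.ne'] at h2
  rw [← h2, ← integral_const_mul]
  refine setIntegral_congr_fun measurableSet_Ioi fun x hx => ?_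
  by_cases hxs : x ∈ s
  · have hxs' : (1 - ρ) * x ∈ (fun x => x / (1 - ρ)) ⁻¹' s := by
      simpa [mul_div_cancel_left₀ _ hb.ne'] using hxs
    simp only [indicator_of_mem hxs, indicator_of_mem hxs', mul_sqrtRatio_sq hp hρ hx, pMinus,
      Pi.one_apply, mul_one]
  · have hxs' : (1 - ρ) * x ∉ (fun x => x / (1 - ρ)) ⁻¹' s := by
      simpa [mul_div_cancel_left₀ _ hb.ne'] using hxs
    simp only [indicator_of_notMem hxs, indicator_of_notMem hxs', mul_zero]

theorem integral_sqrtRatio_sq (hp : IsDelayDensity p) {ρ : ℝ} (hρ : ρ < 1) :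
    ∫ x, sqrtRatio p ρ x ^ 2 ∂delayLaw p = 1 := by
  have hb : 0 < 1 - ρ := by linarith
  rw [integral_delayLaw hp, setIntegral_congr_fun measurableSet_Ioi
    (fun x hx => mul_sqrtRatio_sq hp hρ hx)]
  simp only [pMinus]
  rw [integral_const_mul, integral_comp_mul_left_Ioi p 0 hb, mul_zero, hp.integral_eq_one,
    smul_eq_mul, mul_one, mul_inv_cancel₀ hb.ne']

/-- Second-order lower bound for the Hellinger affinity of the scaling family. -/
theorem exists_affinity_lower_bound (hp : IsDelayDensity p) (hreg : RegularityConditions p) :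
    ∃ δ > 0, ∃ C : ℝ, ∀ ρ ∈ Ioo 0 δ, ρ < 1 ∧
      1 - ρ ^ 2 * bufferConst p / 4 - C * ρ ^ 3 ≤ ∫ x, sqrtRatio p ρ x ∂delayLaw p := by
  obtain ⟨δ, hδ, hδ1, F, G, H, -, -, hH, hb⟩ := hreg.dominated
  refine ⟨δ, hδ, (∫ x in Ioi 0, p x * H x) / 12, fun ρ hρ => ?_⟩
  have hρ1 : ρ < 1 := hρ.2.trans_le hδ1
  refine ⟨hρ1, ?_⟩
  have i0 := hp.integrable
  have i1 := (integrableOn_mul_scoreZero hp hreg).const_mul (ρ / 2)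
  have i2 := (integrableOn_mul_scoreDeriv hp hreg).const_mul (ρ ^ 2 / 4)
  have i3 := hH.const_mul (ρ ^ 3 / 12)
  have i01 : IntegrableOn (fun x => p x - ρ / 2 * (p x * scoreZero p x)) (Ioi 0) := i0.sub i1
  have i012 : IntegrableOn (fun x => p x - ρ / 2 * (p x * scoreZero p x) +
    ρ ^ 2 / 4 * (p x * scoreDeriv p x)) (Ioi 0) := i01.add i2
  -- The first-order term integrates to zero and the second-order one to -cρ²/4.
  have hint : ∫ x in Ioi 0, (p x - ρ / 2 * (p x * scoreZero p x) +
      ρ ^ 2 / 4 * (p x * scoreDeriv p x) - ρ ^ 3 / 12 * (p x * H x)) =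
      1 - ρ ^ 2 * bufferConst p / 4 - (∫ x in Ioi 0, p x * H x) / 12 * ρ ^ 3 := by
    rw [integral_sub i012 i3, integral_add i01 i2, integral_sub i0 i1, integral_const_mul,
      integral_const_mul, integral_const_mul, integral_mul_scoreZero hp hreg,
      integral_mul_scoreDeriv hp hreg, hp.integral_eq_one, bufferConst_eq hp hreg]
    ring
  rw [← hint, integral_delayLaw hp]
  refine setIntegral_mono_on (i012.sub i3)
    ((integrable_delayLaw_iff hp _).1 (integrable_sqrtRatio hp hρ1)) measurableSet_Ioi ?_
  intro x hx
  have hx : 0 < x := hx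
  have hpx := hp.pos x hx
  set L : ℝ → ℝ := fun r => Real.log (pMinus p x r) with hL
  have hder : ∀ k < 3, ∀ r < 1, HasDerivAt (iteratedDeriv k L) (iteratedDeriv (k + 1) L r) r := by
    intro k hk r hr
    have hpos := add_neg_mul_pos hx hr
    rw [iteratedDeriv_succ]
    refine DifferentiableAt.hasDerivAt ?_
    have hd := differentiableAt_iteratedDeriv_logDensity hp hreg hpos hk
    have hd2 : DifferentiableAt ℝ (fun r => (-x) ^ k * ((if k = 0 then Real.log x⁻¹ else 0) +
        iteratedDeriv k (logDensity p) (x + (-x) * r))) r := by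
      refine DifferentiableAt.const_mul (DifferentiableAt.const_add _ ?_) _
      exact hd.comp r (f := fun r => x + (-x) * r) (by fun_prop)
    exact (iteratedDeriv_log_pMinus_eventuallyEq hp hx hr k).differentiableAt_iff.2 hd2
  have ht := taylor_three_le (f := L) (f' := iteratedDeriv 1 L) (f'' := iteratedDeriv 2 L)
    (f''' := iteratedDeriv 3 L) (d := ρ) (M := H x)
    (fun t ht => by simpa using hder 0 (by norm_num) t (by linarith [ht.2]))
    (fun t ht => hder 1 (by norm_num) t (by linarith [ht.2]))
    (fun t ht => hder 2 (by norm_num) t (by linarith [ht.2]))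
    (fun t ht => by
      have := (hb t ⟨ht.1, ht.2.trans hρ.2⟩ x hx).2.2
      linarith [neg_abs_le (iteratedDeriv 3 L t)])
    (right_mem_Icc.2 hρ.1.le)
  have e0 : L 0 = Real.log (p x) := by simp [hL, pMinus]
  have e1 : iteratedDeriv 1 L 0 = - scoreZero p x := by
    rw [hL, iteratedDeriv_log_pMinus_succ hp hx one_pos 0, scoreZero]
    simp
  have e2 : iteratedDeriv 2 L 0 = scoreDeriv p x := by
    rw [hL, iteratedDeriv_log_pMinus_succ hp hx one_pos 1, scoreDeriv]
    simp
  rw [e0, e1, e2] at ht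
  -- This linearisation loses a factor 2 against the true second-order coefficient c/8, which the
  -- threshold 1 - ε²/2 tolerates.
  have hexp := Real.add_one_le_exp ((L ρ - Real.log (p x)) / 2)
  have hle : 1 - ρ / 2 * scoreZero p x + ρ ^ 2 / 4 * scoreDeriv p x - ρ ^ 3 / 12 * H x ≤
      sqrtRatio p ρ x := by
    refine le_trans ?_ hexp
    linarith
  refine le_trans (le_of_eq ?_) (mul_le_mul_of_nonneg_left hle hpx.le)
  ring

end Law

end

/-! ### Laws of the observed delays and covertness -/

section

variable {Ω : Type*} [MeasurableSpace Ω] {μ : Measure Ω} {p : ℝ → ℝ} {A : ℕ → Ω → ℝ}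

theorem measurable_arrivalTime (hA : IsRenewalStream μ p A) (i : ℕ) :
    Measurable (arrivalTime A i) :=
  Finset.measurable_fun_sum _ fun j _ => hA.measurable j

theorem delays_arrivalTime {Ω : Type*} (A : ℕ → Ω → ℝ) (N : ℕ) :
    delays (arrivalTime A) N = fun ω (i : Fin N) => A i ω := by
  ext ω i
  simp [delays, arrivalTime, Finset.sum_range_succ]

theorem delays_stretch {Ω : Type*} (A : ℕ → Ω → ℝ) (ρ : ℝ) (N : ℕ) :
    delays (stretch A ρ) N = fun ω (i : Fin N) => A i ω / (1 - ρ) := by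
  ext ω i
  simp only [delays, stretch, arrivalTime, Finset.sum_range_succ]
  ring

/-- Any `k` consecutive delays have the product law. -/
theorem map_consecutive_delays (hA : IsRenewalStream μ p A) (n k : ℕ) :
    μ.map (fun ω (i : Fin k) => A (n + i) ω) = Measure.pi fun _ => delayLaw p := by
  have h := hA.indep.precomp (g := fun i : Fin k => n + (i : ℕ))
    (fun i j hij => Fin.ext (by simpa using hij))
  rw [h.map_fun_eq_pi_map fun i => (hA.measurable _).aemeasurable]
  simp_rw [hA.law]

theorem map_delays_arrivalTime (hA : IsRenewalStream μ p A) (N : ℕ) :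
    μ.map (delays (arrivalTime A) N) = Measure.pi fun _ => delayLaw p := by
  rw [delays_arrivalTime, ← map_consecutive_delays hA 0 N]
  simp

theorem map_delays_stretch [IsProbabilityMeasure μ] (hp : IsDelayDensity p) (hA : IsRenewalStream μ p A) {ρ : ℝ}
    (hρ : ρ < 1) (N : ℕ) :
    μ.map (delays (stretch A ρ) N) = (Measure.pi fun _ : Fin N => delayLaw p).withDensity
      fun x => ENNReal.ofReal (∏ i, sqrtRatio p ρ (x i) ^ 2) := by
  have := isProbabilityMeasure_delayLaw hp
  have hm : Measurable fun x : ℝ => x / (1 - ρ) := by fun_prop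
  have hlaw : ∀ i, μ.map (fun ω => A i ω / (1 - ρ)) =
      (delayLaw p).withDensity fun x => ENNReal.ofReal (sqrtRatio p ρ x ^ 2) := by
    intro i
    rw [← map_div_delayLaw hp hρ, ← hA.law i, Measure.map_map hm (hA.measurable i)]
    rfl
  have : SigmaFinite ((delayLaw p).withDensity
      fun x => ENNReal.ofReal (sqrtRatio p ρ x ^ 2)) := by
    rw [← hlaw 0]
    infer_instance
  rw [← pi_withDensity_ofReal (integrable_sqrtRatio_sq hp hρ) fun x => sq_nonneg _,
    delays_stretch]
  have h := (hA.indep.precomp (g := fun i : Fin N => (i : ℕ)) Fin.val_injective).comp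
    (fun _ x => x / (1 - ρ)) (fun _ => hm)
  have h2 := h.map_fun_eq_pi_map fun i => (hm.comp (hA.measurable _)).aemeasurable
  simp only [Function.comp_def] at h2
  rw [h2]
  simp_rw [hlaw]

theorem measurable_delays {T : ℕ → Ω → ℝ} (hT : ∀ i, Measurable (T i)) (N : ℕ) :
    Measurable (delays T N) :=
  measurable_pi_lambda _ fun _ => (hT _).sub (hT _)

theorem measurable_stretch (hA : IsRenewalStream μ p A) (ρ : ℝ) (i : ℕ) :
    Measurable (stretch A ρ i) :=
  (measurable_arrivalTime hA i).div_const _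

/-- Before Bob the observation is the same under both hypotheses, so the two errors are
complementary events. -/
theorem probFA_add_probMD_aliceBob [IsProbabilityMeasure μ] (hA : IsRenewalStream μ p A) (D : ℕ → Ω → ℝ) (N : ℕ)
    {R : Set (Fin N → ℝ)} (hR : MeasurableSet R) :
    probFA μ A N R + probMD μ A D Location.aliceBob N R = 1 :=
  probReal_add_probReal_compl
    (measurable_delays (measurable_arrivalTime hA) N hR)

/-- If the affinity of the single-delay laws is close enough to one, the sum of the error
probabilities of every test is close to one. -/
theorem one_sub_le_probFA_add_probMD [IsProbabilityMeasure μ] (hp : IsDelayDensity p) (hA : IsRenewalStream μ p A)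
    {ρ ε : ℝ} (hρ : ρ < 1) (hε : 0 < ε) {N : ℕ}
    (haff : 1 - ε ^ 2 / 2 < (∫ x, sqrtRatio p ρ x ∂delayLaw p) ^ N)
    (loc : Location) {R : Set (Fin N → ℝ)} (hR : MeasurableSet R) :
    1 - ε ≤ probFA μ A N R + probMD μ A (stretch A ρ) loc N R := by
  have := isProbabilityMeasure_delayLaw hp
  cases loc with
  | aliceBob => rw [probFA_add_probMD_aliceBob hA _ N hR]; linarith
  | bobSteve =>
    have hV2 : Integrable (fun x : Fin N → ℝ => (∏ i, sqrtRatio p ρ (x i)) ^ 2)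
        (Measure.pi fun _ => delayLaw p) := by
      simp_rw [← Finset.prod_pow]
      exact Integrable.fintype_prod (f := fun _ x => sqrtRatio p ρ x ^ 2)
        fun i => integrable_sqrtRatio_sq hp hρ
    have hFA : probFA μ A N R = (Measure.pi fun _ : Fin N => delayLaw p).real R := by
      rw [← map_delays_arrivalTime hA N,
        map_measureReal_apply (measurable_delays (measurable_arrivalTime hA) N) hR]
      rfl
    have hMD : probMD μ A (stretch A ρ) Location.bobSteve N R =
        ∫ x in Rᶜ, (∏ i, sqrtRatio p ρ (x i)) ^ 2 ∂(Measure.pi fun _ : Fin N => delayLaw p) := by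
      have h1 : probMD μ A (stretch A ρ) Location.bobSteve N R =
          (μ.map (delays (stretch A ρ) N)).real Rᶜ := by
        rw [map_measureReal_apply (measurable_delays (measurable_stretch hA ρ) N) hR.compl]
        rfl
      rw [h1, map_delays_stretch hp hA hρ, measureReal_def, withDensity_apply _ hR.compl]
      simp_rw [Finset.prod_pow]
      rw [← ofReal_integral_eq_lintegral_ofReal hV2.restrict (ae_of_all _ fun x => sq_nonneg _),
        ENNReal.toReal_ofReal (integral_nonneg fun x => sq_nonneg _)]
    rw [hFA, hMD]
    refine one_sub_le_of_affinity (Integrable.fintype_prod (f := fun _ => sqrtRatio p ρ)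
        fun i => integrable_sqrtRatio hp hρ) hV2 ?_ hR hε ?_
    · simp_rw [← Finset.prod_pow]
      rw [integral_fintype_prod_eq_pow (fun x => sqrtRatio p ρ x ^ 2),
        integral_sqrtRatio_sq hp hρ, one_pow]
    · rw [integral_fintype_prod_eq_pow (sqrtRatio p ρ), Fintype.card_fin]
      exact haff

theorem bufferConst_pos (hp : IsDelayDensity p) (hreg : RegularityConditions p) :
    0 < bufferConst p := by
  rw [bufferConst_eq hp hreg]
  exact fisherInfo_pos hp hreg

theorem tendsto_stretchParam (hc : 0 < bufferConst p) (ε : ℝ) :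
    Tendsto (stretchParam p ε) atTop (𝓝 0) :=
  Tendsto.const_div_atTop (Real.tendsto_sqrt_atTop.comp
    (tendsto_natCast_atTop_atTop.const_mul_atTop hc)) ε

theorem stretchParam_pos (hc : 0 < bufferConst p) {ε : ℝ} (hε : 0 < ε) {N : ℕ} (hN : 0 < N) :
    0 < stretchParam p ε N := by
  have : (0 : ℝ) < N := Nat.cast_pos.2 hN
  unfold stretchParam
  positivity

theorem sq_stretchParam_mul (hc : 0 < bufferConst p) (ε : ℝ) {N : ℕ} (hN : 0 < N) :
    stretchParam p ε N ^ 2 * bufferConst p * N = ε ^ 2 := by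
  have : (0 : ℝ) < N := Nat.cast_pos.2 hN
  rw [stretchParam, div_pow, Real.sq_sqrt (by positivity)]
  field_simp

theorem stretchParam_mul (hc : 0 < bufferConst p) (ε : ℝ) (N : ℕ) :
    stretchParam p ε N * N = ε * √(N / bufferConst p) := by
  rcases Nat.eq_zero_or_pos N with rfl | hN
  · simp
  have : (0 : ℝ) < N := Nat.cast_pos.2 hN
  rw [stretchParam, Real.sqrt_mul hc.le, Real.sqrt_div this.le]
  have h1 := Real.sqrt_pos.2 hc
  have h2 := Real.sqrt_pos.2 this
  have h3 := Real.sq_sqrt this.le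
  field_simp
  rw [h3]

theorem eventually_covert [IsProbabilityMeasure μ] (hp : IsDelayDensity p) (hreg : RegularityConditions p)
    (hA : IsRenewalStream μ p A) {ε : ℝ} (hε : 0 < ε) :
    ∀ᶠ N : ℕ in atTop, ∀ loc : Location, ∀ R : Set (Fin N → ℝ), MeasurableSet R →
      1 - ε ≤ probFA μ A N R + probMD μ A (stretch A (stretchParam p ε N)) loc N R := by
  have hc := bufferConst_pos hp hreg
  obtain ⟨δ, hδ, C, hC⟩ := exists_affinity_lower_bound hp hreg
  have hlim := tendsto_stretchParam hc ε
  have h1 : Tendsto (fun N => stretchParam p ε N ^ 2 * bufferConst p / 4 +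
      C * stretchParam p ε N ^ 3) atTop (𝓝 0) := by
    have := ((hlim.pow 2).mul_const (bufferConst p)).div_const 4 |>.add
      ((hlim.pow 3).const_mul C)
    simpa using this
  have h2 : Tendsto (fun N => C * (ε ^ 2 / bufferConst p) * stretchParam p ε N) atTop (𝓝 0) := by
    simpa using hlim.const_mul (C * (ε ^ 2 / bufferConst p))
  filter_upwards [eventually_gt_atTop 0, hlim.eventually_lt_const hδ,
    h1.eventually_lt_const one_pos,
    h2.eventually_lt_const (show 0 < ε ^ 2 / 4 by positivity)] with N hN hρδ hu hCρ loc R hR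
  have hρ0 := stretchParam_pos hc hε hN
  obtain ⟨hρ1, hB⟩ := hC _ ⟨hρ0, hρδ⟩
  refine one_sub_le_probFA_add_probMD hp hA hρ1 hε ?_ loc hR
  have hsq := sq_stretchParam_mul hc ε hN
  set ρ := stretchParam p ε N
  set u := ρ ^ 2 * bufferConst p / 4 + C * ρ ^ 3 with hudef
  -- Since ρ²cN = ε², the quadratic part contributes ε²/4 and the cubic part is a multiple of ρ,
  -- eventually below ε²/4.
  have hNu : N * u < ε ^ 2 / 2 := by
    have e1 : (N : ℝ) * u = (ρ ^ 2 * bufferConst p * N) / 4 +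
        C * ((ρ ^ 2 * bufferConst p * N) / bufferConst p) * ρ := by
      rw [hudef]; field_simp
    rw [e1, hsq]
    linarith
  have hbern := one_add_mul_le_pow (show (-2 : ℝ) ≤ -u by linarith) N
  calc 1 - ε ^ 2 / 2 < 1 + N * (-u) := by linarith
    _ ≤ (1 + -u) ^ N := hbern
    _ ≤ _ := by
      refine pow_le_pow_left₀ (by linarith) ?_ N
      refine le_trans (le_of_eq ?_) hB
      rw [hudef]; ring

end

/-! ### Arrival counts and the buffer size of the stretching scheme -/

section

/-- The mean delay `λ⁻¹`. -/
noncomputable def meanDelay (p : ℝ → ℝ) : ℝ := ∫ x in Ioi (0 : ℝ), x * p x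

theorem inv_rate (p : ℝ → ℝ) : (rate p)⁻¹ = meanDelay p := inv_inv _

variable {Ω : Type*} [MeasurableSpace Ω] {μ : Measure Ω} {p : ℝ → ℝ} {A : ℕ → Ω → ℝ}

theorem meanDelay_eq (hp : IsDelayDensity p) : meanDelay p = ∫ x, x ∂delayLaw p := by
  rw [integral_delayLaw hp, meanDelay]
  simp_rw [mul_comm]

theorem integrable_id_delayLaw (hp : IsDelayDensity p) : Integrable (fun x => x) (delayLaw p) := by
  rw [integrable_delayLaw_iff hp]
  simpa only [mul_comm] using hp.integrable_mean

theorem integral_pos_of_forall_pos {f : ℝ → ℝ} (hf : IntegrableOn f (Ioi 0))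
    (hpos : ∀ᵐ x ∂volume.restrict (Ioi (0 : ℝ)), 0 < f x) : 0 < ∫ x in Ioi 0, f x := by
  have hnn : 0 ≤ᵐ[volume.restrict (Ioi (0 : ℝ))] f := hpos.mono fun x hx => hx.le
  refine lt_of_le_of_ne (integral_nonneg_of_ae hnn) fun h0 => ?_
  have h1 := (integral_eq_zero_iff_of_nonneg_ae hnn hf).1 h0.symm
  have h2 : ∀ᵐ x ∂volume.restrict (Ioi (0 : ℝ)), False := by
    filter_upwards [h1, hpos] with x hx hx'
    exact hx'.ne' hx
  rw [eventually_false_iff_eq_bot, ae_eq_bot, Measure.restrict_eq_zero] at h2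
  simp at h2

theorem meanDelay_pos (hp : IsDelayDensity p) : 0 < meanDelay p :=
  integral_pos_of_forall_pos hp.integrable_mean
    ((ae_restrict_mem measurableSet_Ioi).mono fun x hx => mul_pos hx (hp.pos x hx))

theorem identDistrib_delay (hA : IsRenewalStream μ p A) (i : ℕ) :
    IdentDistrib (A i) (A 0) μ μ :=
  ⟨(hA.measurable i).aemeasurable, (hA.measurable 0).aemeasurable, by rw [hA.law, hA.law]⟩

theorem integral_delay (hp : IsDelayDensity p) (hA : IsRenewalStream μ p A) (i : ℕ) :
    ∫ ω, A i ω ∂μ = meanDelay p := by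
  rw [meanDelay_eq hp, ← hA.law i]
  exact (integral_map (hA.measurable i).aemeasurable aestronglyMeasurable_id).symm

theorem integrable_delay (hp : IsDelayDensity p) (hA : IsRenewalStream μ p A) (i : ℕ) :
    Integrable (A i) μ := by
  have h := integrable_id_delayLaw hp
  rw [← hA.law i] at h
  exact (integrable_map_measure aestronglyMeasurable_id (hA.measurable i).aemeasurable).1 h

theorem ae_delay_pos (hA : IsRenewalStream μ p A) : ∀ᵐ ω ∂μ, ∀ i, 0 < A i ω := by
  rw [ae_all_iff]
  intro i
  have h := ae_delayLaw_pos (p := p)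
  rw [← hA.law i] at h
  exact ae_of_ae_map (hA.measurable i).aemeasurable h

theorem monotone_arrivalTime {Ω : Type*} {A : ℕ → Ω → ℝ} {ω : Ω} (h : ∀ i, 0 < A i ω) :
    Monotone fun i => arrivalTime A i ω :=
  monotone_nat_of_le_succ fun n => by
    simp only [arrivalTime, Finset.sum_range_succ]
    linarith [h n]

theorem ae_tendsto_arrivalTime_div (hp : IsDelayDensity p) (hA : IsRenewalStream μ p A) :
    ∀ᵐ ω ∂μ, Tendsto (fun n : ℕ => arrivalTime A n ω / n) atTop (𝓝 (meanDelay p)) := by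
  have h := strong_law_ae_real A (integrable_delay hp hA 0)
    (fun i j hij => hA.indep.indepFun hij) (identDistrib_delay hA)
  rwa [integral_delay hp hA] at h

theorem ae_tendsto_arrivalTime (hp : IsDelayDensity p) (hA : IsRenewalStream μ p A) :
    ∀ᵐ ω ∂μ, Tendsto (fun n => arrivalTime A n ω) atTop atTop := by
  filter_upwards [ae_tendsto_arrivalTime_div hp hA] with ω hω
  have h := hω.pos_mul_atTop (meanDelay_pos hp) tendsto_natCast_atTop_atTop
  refine h.congr' ?_
  filter_upwards [eventually_gt_atTop 0] with n hn
  have : (n : ℝ) ≠ 0 := Nat.cast_ne_zero.2 hn.ne'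
  field_simp

theorem le_arrivalCount_iff {Ω : Type*} {A : ℕ → Ω → ℝ} {ω : Ω} (hmono : Monotone fun i => arrivalTime A i ω)
    (htop : Tendsto (fun n => arrivalTime A n ω) atTop atTop) {t : ℝ} (ht : 0 ≤ t) (k : ℕ) :
    k ≤ arrivalCount A t ω ↔ arrivalTime A k ω ≤ t := by
  have hbdd : BddAbove {i : ℕ | arrivalTime A i ω ≤ t} := by
    obtain ⟨n, hn⟩ := (htop.eventually_gt_atTop t).exists
    exact ⟨n, fun i hi => le_of_not_gt fun h => absurd (hmono h.le) (not_le.2 (hi.trans_lt hn))⟩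
  -- `sSup` on ℕ defaults to 0 for empty or unbounded sets; t ≥ 0 and τ → ∞ exclude both.
  have hne : {i : ℕ | arrivalTime A i ω ≤ t}.Nonempty := ⟨0, by simpa [arrivalTime] using ht⟩
  refine ⟨fun h => (hmono h).trans (Nat.sSup_mem hne hbdd), fun h => le_csSup hbdd h⟩

/-- Almost surely, `X(t) ≥ k` is the same as `τ(k) ≤ t`, for all `t ≥ 0`. -/
theorem ae_le_arrivalCount_iff (hp : IsDelayDensity p) (hA : IsRenewalStream μ p A) :
    ∀ᵐ ω ∂μ, ∀ t : ℝ, 0 ≤ t → ∀ k, k ≤ arrivalCount A t ω ↔ arrivalTime A k ω ≤ t := by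
  filter_upwards [ae_delay_pos hA, ae_tendsto_arrivalTime hp hA] with ω h1 h2 t ht k
  exact le_arrivalCount_iff (monotone_arrivalTime h1) h2 ht k

theorem le_buffered_iff {Ω : Type*} (A D : ℕ → Ω → ℝ) (N : ℕ) (ω : Ω) {K : ℝ} (hK : 0 ≤ K) :
    K ≤ buffered A D N ω ↔ N + ⌈K⌉₊ ≤ arrivalCount A (D N ω) ω := by
  rw [buffered, le_sub_iff_add_le', ← Nat.ceil_le, add_comm, Nat.ceil_add_natCast hK, add_comm]

/-- Stationarity of increments: it turns the law of large numbers for τ(k) into one for the block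
after packet n, even when both n and k vary. -/
theorem measure_consecutive_sum (hA : IsRenewalStream μ p A) (n k : ℕ) {s : Set ℝ}
    (hs : MeasurableSet s) :
    μ.real {ω | arrivalTime A (n + k) ω - arrivalTime A n ω ∈ s} =
      μ.real {ω | arrivalTime A k ω ∈ s} := by
  have hsum : Measurable fun x : Fin k → ℝ => ∑ i, x i :=
    Finset.measurable_fun_sum _ fun i _ => measurable_pi_apply i
  have key : ∀ n, μ.real {ω | arrivalTime A (n + k) ω - arrivalTime A n ω ∈ s} =
      (Measure.pi fun _ : Fin k => delayLaw p).real ((fun x : Fin k → ℝ => ∑ i, x i) ⁻¹' s) := by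
    intro n
    rw [← map_consecutive_delays hA n k, map_measureReal_apply
      (measurable_pi_lambda _ fun i => hA.measurable _) (hsum hs)]
    congr 1
    ext ω
    simp only [arrivalTime, mem_ofPred_eq, mem_preimage, Finset.sum_range_add,
      Fin.sum_univ_eq_sum_range (fun i => A (n + i) ω), add_sub_cancel_left]
  rw [key n, ← key 0]
  simp [arrivalTime]

theorem tendsto_measure_arrivalTime_div [IsProbabilityMeasure μ] (hp : IsDelayDensity p)
    (hA : IsRenewalStream μ p A) {ε : ℝ} (hε : 0 < ε) :
    Tendsto (fun n : ℕ => μ.real {ω | arrivalTime A n ω ∈ {s : ℝ | ε ≤ |s / n - meanDelay p|}})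
      atTop (𝓝 0) :=
  tendstoInMeasure_iff_measureReal_norm.1 (tendstoInMeasure_of_tendsto_ae
    (fun n => ((measurable_arrivalTime hA n).div_const _).aestronglyMeasurable)
    (ae_tendsto_arrivalTime_div hp hA)) ε hε

/-- Subadditivity suffices, so no measurability of the buffer events is required. -/
theorem tendsto_one_of_ae_mem_or_mem [IsProbabilityMeasure μ] {E B : ℕ → Set Ω}
    (h : ∀ᶠ N in atTop, ∀ᵐ ω ∂μ, ω ∈ E N ∨ ω ∈ B N)
    (hB : Tendsto (fun N => μ.real (B N)) atTop (𝓝 0)) :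
    Tendsto (fun N => μ.real (E N)) atTop (𝓝 1) := by
  refine tendsto_of_tendsto_of_tendsto_of_le_of_le' (g := fun N => 1 - μ.real (B N))
    (by simpa using hB.const_sub 1) tendsto_const_nhds ?_ (Eventually.of_forall fun N =>
      measureReal_le_one)
  filter_upwards [h] with N hN
  have h1 : μ.real (E N ∪ B N) = 1 := by
    rw [← probReal_univ (μ := μ)]
    exact measureReal_congr (eventuallyEq_univ.2 hN)
  linarith [measureReal_union_le (μ := μ) (E N) (B N)]

/-- Deviation of the arrival times from their mean, at `n` and over the `k n` subsequent packets. -/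
theorem tendsto_measure_deviation [IsProbabilityMeasure μ] (hp : IsDelayDensity p)
    (hA : IsRenewalStream μ p A) {ε : ℝ} (hε : 0 < ε) {k : ℕ → ℕ} (hk : Tendsto k atTop atTop) :
    Tendsto (fun n : ℕ => μ.real ({ω | ε ≤ |arrivalTime A n ω / n - meanDelay p|} ∪
      {ω | ε ≤ |(arrivalTime A (n + k n) ω - arrivalTime A n ω) / (k n : ℕ) - meanDelay p|}))
      atTop (𝓝 0) := by
  have h1 := tendsto_measure_arrivalTime_div hp hA hε
  have h2 := (h1.comp hk).congr fun n => by
    have hs : MeasurableSet {s : ℝ | ε ≤ |s / (k n : ℕ) - meanDelay p|} :=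
      measurableSet_le measurable_const (by fun_prop)
    exact (measure_consecutive_sum hA n (k n) hs).symm
  refine squeeze_zero (fun n => measureReal_nonneg) (fun n => measureReal_union_le _ _) ?_
  simpa using h1.add h2

theorem abs_div_sub_lt {a b ε m : ℝ} (hb : 0 < b) (h : ¬ ε ≤ |a / b - m|) :
    (m - ε) * b < a ∧ a < (m + ε) * b := by
  rw [not_le, abs_lt] at h
  constructor
  · rw [← lt_div_iff₀ hb]; linarith
  · rw [← div_lt_iff₀ hb]; linarith

theorem isBufferingScheme_stretch (hA : IsRenewalStream μ p A) {ρ : ℝ} (h0 : 0 ≤ ρ) (h1 : ρ < 1) :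
    IsBufferingScheme μ A (stretch A ρ) where
  measurable := measurable_stretch hA ρ
  start := ae_of_all _ fun ω => by simp [stretch, arrivalTime]
  mono := by
    filter_upwards [ae_delay_pos hA] with ω hω i j hij
    exact div_le_div_of_nonneg_right (monotone_arrivalTime hω hij) (by linarith)
  causal := by
    filter_upwards [ae_delay_pos hA] with ω hω i
    have h : 0 ≤ arrivalTime A i ω := Finset.sum_nonneg fun j _ => (hω j).le
    rw [stretch, le_div_iff₀ (by linarith)]
    nlinarith

theorem tendsto_stretchParam_mul (hc : 0 < bufferConst p) {ε : ℝ} (hε : 0 < ε) :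
    Tendsto (fun N : ℕ => stretchParam p ε N * N) atTop atTop := by
  simp_rw [stretchParam_mul hc]
  exact (Real.tendsto_sqrt_atTop.comp
    (tendsto_natCast_atTop_atTop.atTop_div_const hc)).const_mul_atTop hε

theorem lower_bound_eq (hc : 0 < bufferConst p) (ε : ℝ) (N : ℕ) :
    ε * √((N : ℝ) / (4 * bufferConst p)) = stretchParam p ε N * N / 2 := by
  have : (N : ℝ) / (4 * bufferConst p) = (1 / 2) ^ 2 * (N / bufferConst p) := by
    field_simp; norm_num
  rw [stretchParam_mul hc, this, Real.sqrt_mul (by positivity), Real.sqrt_sq (by norm_num)]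
  ring

theorem upper_bound_eq (hc : 0 < bufferConst p) (ε : ℝ) (N : ℕ) :
    ε * √(4 * (N : ℝ) / bufferConst p) = 2 * (stretchParam p ε N * N) := by
  have : 4 * (N : ℝ) / bufferConst p = 2 ^ 2 * (N / bufferConst p) := by ring
  rw [stretchParam_mul hc, this, Real.sqrt_mul (by positivity), Real.sqrt_sq (by norm_num)]
  ring

theorem tendsto_buffered_ge [IsProbabilityMeasure μ] (hp : IsDelayDensity p)
    (hreg : RegularityConditions p)
    (hA : IsRenewalStream μ p A) {ε : ℝ} (hε : 0 < ε) :
    Tendsto (fun N : ℕ => μ.real {ω | ε * √((N : ℝ) / (4 * bufferConst p)) ≤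
      buffered A (stretch A (stretchParam p ε N)) N ω}) atTop (𝓝 1) := by
  have hc := bufferConst_pos hp hreg
  have hm := meanDelay_pos hp
  have hρ := tendsto_stretchParam hc ε
  have hρN := tendsto_stretchParam_mul hc hε
  have hk : Tendsto (fun N : ℕ => ⌈stretchParam p ε N * N / 2⌉₊) atTop atTop :=
    tendsto_nat_ceil_atTop.comp (hρN.atTop_div_const two_pos)
  refine tendsto_one_of_ae_mem_or_mem ?_
    (tendsto_measure_deviation hp hA (show 0 < meanDelay p / 10 by positivity) hk)
  filter_upwards [eventually_gt_atTop 0, hρ.eventually_lt_const one_pos,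
    -- With relative errors of 1/10, ρN > 10 absorbs the rounding: 1.1(ρN/2 + 1) ≤ 0.9 ρN.
    hρN.eventually_gt_atTop 10, hk.eventually_gt_atTop 0] with N hN hρ1 hρN hk0
  filter_upwards [ae_delay_pos hA, ae_le_arrivalCount_iff hp hA] with ω hpos hX
  rw [or_iff_not_imp_right]
  intro hB
  simp only [mem_union, mem_ofPred_eq, not_or] at hB ⊢
  have hN' : (0 : ℝ) < N := Nat.cast_pos.2 hN
  have hρ0 := stretchParam_pos hc hε hN
  rw [lower_bound_eq hc]
  set ρ := stretchParam p ε N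
  set m := meanDelay p
  have hk' : (0 : ℝ) < ⌈ρ * N / 2⌉₊ := Nat.cast_pos.2 hk0
  obtain ⟨h1, -⟩ := abs_div_sub_lt hN' hB.1
  obtain ⟨-, h2⟩ := abs_div_sub_lt hk' hB.2
  have hceil : (⌈ρ * N / 2⌉₊ : ℝ) < ρ * N / 2 + 1 := Nat.ceil_lt_add_one (by positivity)
  have hτ : 0 ≤ arrivalTime A N ω := Finset.sum_nonneg fun j _ => (hpos j).le
  rw [le_buffered_iff _ _ _ _ (by positivity), stretch, hX _ (div_nonneg hτ (by linarith)),
    le_div_iff₀ (by linarith)]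
  set k := (⌈ρ * N / 2⌉₊ : ℝ)
  set τ := arrivalTime A N ω
  have h3 : arrivalTime A (N + ⌈ρ * N / 2⌉₊) ω ≤ τ + ρ * τ := by
    have e1 : (m + m / 10) * k ≤ (m + m / 10) * (ρ * N / 2 + 1) := by gcongr
    have e2 : ρ * ((m - m / 10) * N) ≤ ρ * τ := by gcongr
    nlinarith [mul_lt_mul_of_pos_left hρN hm]
  -- This is 1 + ρ ≤ 1/(1 - ρ) with the denominator cleared.
  have h4 : (τ + ρ * τ) * (1 - ρ) ≤ τ := by nlinarith [mul_nonneg (sq_nonneg ρ) hτ]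
  exact (mul_le_mul_of_nonneg_right h3 (by linarith)).trans h4

theorem tendsto_buffered_le [IsProbabilityMeasure μ] (hp : IsDelayDensity p)
    (hreg : RegularityConditions p)
    (hA : IsRenewalStream μ p A) {ε : ℝ} (hε : 0 < ε) :
    Tendsto (fun N : ℕ => μ.real {ω | buffered A (stretch A (stretchParam p ε N)) N ω ≤
      ε * √(4 * (N : ℝ) / bufferConst p)}) atTop (𝓝 1) := by
  have hc := bufferConst_pos hp hreg
  have hm := meanDelay_pos hp
  have hρ := tendsto_stretchParam hc ε
  have hρN := tendsto_stretchParam_mul hc hε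
  have hk : Tendsto (fun N : ℕ => ⌈2 * (stretchParam p ε N * N)⌉₊) atTop atTop :=
    tendsto_nat_ceil_atTop.comp (hρN.const_mul_atTop two_pos)
  refine tendsto_one_of_ae_mem_or_mem ?_
    (tendsto_measure_deviation hp hA (show 0 < meanDelay p / 10 by positivity) hk)
  filter_upwards [eventually_gt_atTop 0,
    -- An overfull buffer would give 0.9 · 2 · (1 - ρ) ≤ 1.1, which fails for ρ < 1/3.
    hρ.eventually_lt_const (show (0 : ℝ) < 1 / 3 by norm_num), hk.eventually_gt_atTop 0]
    with N hN hρ1 hk0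
  filter_upwards [ae_delay_pos hA, ae_le_arrivalCount_iff hp hA] with ω hpos hX
  rw [or_iff_not_imp_right]
  intro hB
  simp only [mem_union, mem_ofPred_eq, not_or] at hB ⊢
  have hN' : (0 : ℝ) < N := Nat.cast_pos.2 hN
  have hρ0 := stretchParam_pos hc hε hN
  rw [upper_bound_eq hc]
  set ρ := stretchParam p ε N
  set m := meanDelay p
  have hk' : (0 : ℝ) < ⌈2 * (ρ * N)⌉₊ := Nat.cast_pos.2 hk0
  obtain ⟨-, h1⟩ := abs_div_sub_lt hN' hB.1
  obtain ⟨h2, -⟩ := abs_div_sub_lt hk' hB.2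
  have hceil : 2 * (ρ * N) ≤ (⌈2 * (ρ * N)⌉₊ : ℝ) := Nat.le_ceil _
  have hτ : 0 ≤ arrivalTime A N ω := Finset.sum_nonneg fun j _ => (hpos j).le
  by_contra! hlt
  have h3 := (le_buffered_iff _ _ _ _ (by positivity)).1 hlt.le
  rw [stretch, hX _ (div_nonneg hτ (by linarith)), le_div_iff₀ (by linarith)] at h3
  set k := (⌈2 * (ρ * N)⌉₊ : ℝ)
  set τ := arrivalTime A N ω
  have e1 : (m - m / 10) * (2 * (ρ * N)) ≤ (m - m / 10) * k := by
    refine mul_le_mul_of_nonneg_left hceil (by linarith)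
  have h4 : (τ + (m - m / 10) * (2 * (ρ * N))) * (1 - ρ) ≤ τ := by
    refine (mul_le_mul_of_nonneg_right ?_ (by linarith)).trans h3
    linarith
  have h5 : ρ * τ ≤ ρ * ((m + m / 10) * N) := by gcongr
  have h6 : 0 < m * (ρ * N) := by positivity
  nlinarith

end

/-! ### Converse: Chebyshev bounds for the threshold test -/

section

variable {Ω : Type*} [MeasurableSpace Ω] {μ : Measure Ω} {p : ℝ → ℝ} {A : ℕ → Ω → ℝ}

theorem integrable_sq_delayLaw (hp : IsDelayDensity p)
    (h2 : IntegrableOn (fun x => x ^ 2 * p x) (Ioi 0)) :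
    Integrable (fun x => x ^ 2) (delayLaw p) := by
  rw [integrable_delayLaw_iff hp]
  simpa only [mul_comm] using h2

theorem memLp_delay (hp : IsDelayDensity p) (hA : IsRenewalStream μ p A)
    (h2 : IntegrableOn (fun x => x ^ 2 * p x) (Ioi 0)) (i : ℕ) : MemLp (A i) 2 μ := by
  rw [memLp_two_iff_integrable_sq (hA.measurable i).aestronglyMeasurable]
  have h := integrable_sq_delayLaw hp h2
  rw [← hA.law i] at h
  exact (integrable_map_measure (by fun_prop) (hA.measurable i).aemeasurable).1 h

theorem variance_delay (hp : IsDelayDensity p) (hA : IsRenewalStream μ p A) (i : ℕ) :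
    Var[A i; μ] = delayVariance p := by
  rw [variance_eq_integral (hA.measurable i).aemeasurable, integral_delay hp hA]
  have h : ∫ x, (x - meanDelay p) ^ 2 ∂μ.map (A i) = ∫ ω, (A i ω - meanDelay p) ^ 2 ∂μ :=
    integral_map (hA.measurable i).aemeasurable (by fun_prop)
  rw [← h, hA.law, integral_delayLaw hp, delayVariance, inv_rate]
  simp_rw [mul_comm]

theorem delayVariance_pos (hp : IsDelayDensity p)
    (h2 : IntegrableOn (fun x => x ^ 2 * p x) (Ioi 0)) : 0 < delayVariance p := by
  refine integral_pos_of_forall_pos ?_ ?_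
  · refine ((h2.sub (hp.integrable_mean.const_mul (2 * (rate p)⁻¹))).add
      (hp.integrable.const_mul ((rate p)⁻¹ ^ 2))).congr (ae_of_all _ fun x => ?_)
    simp only [Pi.add_apply, Pi.sub_apply]
    ring
  · have h : ∀ᵐ x ∂volume.restrict (Ioi (0 : ℝ)), x ≠ (rate p)⁻¹ :=
      ae_restrict_of_ae (Measure.ae_ne volume _)
    filter_upwards [ae_restrict_mem measurableSet_Ioi, h] with x hx hne
    have := hp.pos x hx
    have := sub_ne_zero.2 hne
    positivity

theorem measure_deviation_le [IsProbabilityMeasure μ] (hp : IsDelayDensity p)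
    (hA : IsRenewalStream μ p A) (h2 : IntegrableOn (fun x => x ^ 2 * p x) (Ioi 0)) (n : ℕ)
    {c : ℝ} (hc : 0 < c) :
    μ.real {ω | c ≤ |arrivalTime A n ω - n * meanDelay p|} ≤ n * delayVariance p / c ^ 2 := by
  have hsum : arrivalTime A n = ∑ i ∈ Finset.range n, A i := by
    ext ω
    simp [arrivalTime]
  have hL : MemLp (arrivalTime A n) 2 μ := by
    rw [hsum]
    exact memLp_finsetSum' _ fun i _ => memLp_delay hp hA h2 i
  have hE : ∫ ω, arrivalTime A n ω ∂μ = n * meanDelay p := by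
    simp only [arrivalTime]
    rw [integral_finsetSum _ fun i _ => integrable_delay hp hA i]
    simp [integral_delay hp hA]
  have hV : Var[arrivalTime A n; μ] = n * delayVariance p := by
    rw [hsum, IndepFun.variance_sum (fun i _ => memLp_delay hp hA h2 i)
      fun i _ j _ hij => hA.indep.indepFun hij]
    simp [variance_delay hp hA]
  have h := meas_ge_le_variance_div_sq hL hc
  rw [hE, hV] at h
  have hσ := (delayVariance_pos hp h2).le
  exact ENNReal.toReal_le_of_le_ofReal (by positivity) h

theorem sum_delays {Ω : Type*} (T : ℕ → Ω → ℝ) (N : ℕ) (ω : Ω) :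
    ∑ i, delays T N ω i = T N ω - T 0 ω := by
  simp only [delays]
  rw [Fin.sum_univ_eq_sum_range (fun i => T (i + 1) ω - T i ω) N,
    Finset.sum_range_sub fun i => T i ω]

theorem mem_thresholdRegion {U : ℝ} {N : ℕ} (hN : 0 < N) (x : Fin N → ℝ) :
    x ∈ thresholdRegion p U N ↔ N * meanDelay p + N * U < ∑ i, x i := by
  have hN' : (0 : ℝ) < N := Nat.cast_pos.2 hN
  rw [thresholdRegion, mem_ofPred_eq, inv_rate, lt_div_iff₀ hN']
  ring_nf

theorem mul_threshold (hσ : 0 ≤ delayVariance p) {α : ℝ} (hα : 0 < α) {N : ℕ} (hN : 0 < N) :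
    N * threshold p α N = √N * √(delayVariance p / α) := by
  have hN' : (0 : ℝ) < N := Nat.cast_pos.2 hN
  rw [threshold, ← div_div, Real.sqrt_div (by positivity)]
  have h := Real.sq_sqrt hN'.le
  have h1 := Real.sqrt_pos.2 hN'
  field_simp
  rw [h, mul_comm]

theorem probFA_threshold_le [IsProbabilityMeasure μ] (hp : IsDelayDensity p)
    (hA : IsRenewalStream μ p A) (h2 : IntegrableOn (fun x => x ^ 2 * p x) (Ioi 0)) {α : ℝ}
    (hα : 0 < α) {N : ℕ} (hN : 0 < N) :
    probFA μ A N (thresholdRegion p (threshold p α N) N) ≤ α := by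
  have hN' : (0 : ℝ) < N := Nat.cast_pos.2 hN
  have hσ := delayVariance_pos hp h2
  have hc : 0 < √(N : ℝ) * √(delayVariance p / α) :=
    mul_pos (Real.sqrt_pos.2 hN') (Real.sqrt_pos.2 (by positivity))
  refine le_trans (measureReal_mono ?_) ((measure_deviation_le hp hA h2 N hc).trans ?_)
  · intro ω hω
    rw [mem_ofPred_eq, mem_thresholdRegion hN, sum_delays, mul_threshold hσ.le hα hN] at hω
    have h0 : arrivalTime A 0 ω = 0 := by simp [arrivalTime]
    rw [mem_ofPred_eq]
    exact le_trans (by linarith) (le_abs_self _)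
  · rw [mul_pow, Real.sq_sqrt hN'.le, Real.sq_sqrt (by positivity)]
    apply le_of_eq
    field_simp

/-- Buffering at least `K` packets means that packet `N + ⌈K⌉` has arrived when the `N`-th packet
is transmitted. -/
theorem le_buffered_ae_eq (hp : IsDelayDensity p) (hA : IsRenewalStream μ p A) {D : ℕ → Ω → ℝ}
    (hD : IsBufferingScheme μ A D) (N : ℕ) {K : ℝ} (hK : 0 ≤ K) :
    {ω | K ≤ buffered A D N ω} =ᵐ[μ] {ω | arrivalTime A (N + ⌈K⌉₊) ω ≤ D N ω} := by
  filter_upwards [ae_le_arrivalCount_iff hp hA, hD.start, hD.mono] with ω hX h0 hmono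
  -- The description of `arrivalCount` by arrival times holds only at nonnegative times.
  have hDN : 0 ≤ D N ω := h0 ▸ hmono (Nat.zero_le N)
  exact propext ((le_buffered_iff A D N ω hK).trans (hX _ hDN _))

theorem probMD_threshold_le [IsProbabilityMeasure μ] (hp : IsDelayDensity p)
    (hA : IsRenewalStream μ p A) (h2 : IntegrableOn (fun x => x ^ 2 * p x) (Ioi 0)) {α : ℝ}
    (hα : 0 < α) {D : ℕ → Ω → ℝ} (hD : IsBufferingScheme μ A D) {K c : ℝ} (hK : 0 ≤ K)
    (hc : 0 < c) (hKc : √(delayVariance p / α) + c ≤ K * meanDelay p) {N : ℕ}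
    (hN : (K + 1) ^ 2 ≤ N) :
    probMD μ A D Location.bobSteve N (thresholdRegion p (threshold p α N) N) ≤
      (1 - μ.real {ω | K * √N ≤ buffered A D N ω}) + 2 * delayVariance p / c ^ 2 := by
  have hN' : (0 : ℝ) < N := lt_of_lt_of_le (by positivity) hN
  have hN0 : 0 < N := Nat.cast_pos.1 hN'
  have hσ := delayVariance_pos hp h2
  have hm := meanDelay_pos hp
  have hsq : 0 < √(N : ℝ) := Real.sqrt_pos.2 hN'
  have hsqsq : √(N : ℝ) ^ 2 = N := Real.sq_sqrt hN'.le
  have hK1 : K + 1 ≤ √(N : ℝ) := Real.le_sqrt_of_sq_le hN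
  set k := ⌈K * √(N : ℝ)⌉₊ with hk
  have hk1 : K * √(N : ℝ) ≤ k := Nat.le_ceil _
  -- Here (K + 1)² ≤ N enters: it gives N + k ≤ 2N, the source of the factor 2 in the variance
  -- bound.
  have hk2 : (k : ℝ) ≤ N := by
    have : (k : ℝ) < K * √(N : ℝ) + 1 := Nat.ceil_lt_add_one (by positivity)
    nlinarith
  have hmeas : MeasurableSet {ω | arrivalTime A (N + k) ω ≤ D N ω} :=
    measurableSet_le (measurable_arrivalTime hA _) (hD.measurable N)
  have hcs : 0 < c * √(N : ℝ) := by positivity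
  have hsub : ({ω | delays D N ω ∉ thresholdRegion p (threshold p α N) N} : Set Ω) ≤ᵐ[μ]
      ({ω | arrivalTime A (N + k) ω ≤ D N ω}ᶜ ∪ {ω | c * √(N : ℝ) ≤
        |arrivalTime A (N + k) ω - (N + k : ℕ) * meanDelay p|} : Set Ω) := by
    filter_upwards [hD.start] with ω h0 hω
    change delays D N ω ∉ thresholdRegion p (threshold p α N) N at hω
    change ω ∈ (_ ∪ _ : Set Ω)
    rw [mem_thresholdRegion hN0, sum_delays, h0, mul_threshold hσ.le hα hN0, not_lt] at hω
    rw [mem_union, or_iff_not_imp_left, mem_compl_iff, not_not]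
    intro hle
    rw [mem_ofPred_eq] at hle ⊢
    rw [abs_sub_comm]
    refine le_trans ?_ (le_abs_self _)
    push_cast
    -- The k extra packets raise the mean of τ(N + k) by at least (√(σ²/α) + c)√N. The threshold
    -- offset uses up only the first summand, which leaves a deviation of c√N.
    have h3 : K * √(N : ℝ) * meanDelay p ≤ k * meanDelay p := by gcongr
    have h4 := mul_le_mul_of_nonneg_left hKc hsq.le
    nlinarith
  calc probMD μ A D Location.bobSteve N (thresholdRegion p (threshold p α N) N)
      ≤ μ.real ({ω | arrivalTime A (N + k) ω ≤ D N ω}ᶜ ∪ {ω | c * √(N : ℝ) ≤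
        |arrivalTime A (N + k) ω - (N + k : ℕ) * meanDelay p|}) :=
        ENNReal.toReal_mono (measure_ne_top _ _) (measure_mono_ae hsub)
    _ ≤ _ := measureReal_union_le _ _
    _ ≤ _ := by
      rw [probReal_compl_eq_one_sub hmeas,
        measureReal_congr (le_buffered_ae_eq hp hA hD N (by positivity))]
      refine add_le_add_right ((measure_deviation_le hp hA h2 (N + k) hcs).trans ?_) _
      rw [mul_pow, hsqsq, div_le_div_iff₀ (by positivity) (by positivity)]
      push_cast
      have : (N + k : ℝ) * (delayVariance p * c ^ 2) ≤ (2 * N) * (delayVariance p * c ^ 2) := by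
        gcongr
        linarith
      linarith

theorem tendsto_probMD_threshold [IsProbabilityMeasure μ] (hp : IsDelayDensity p)
    (hA : IsRenewalStream μ p A) (h2 : IntegrableOn (fun x => x ^ 2 * p x) (Ioi 0)) {α : ℝ}
    (hα : 0 < α) {D : ℕ → ℕ → Ω → ℝ} (hD : ∀ N, IsBufferingScheme μ A (D N))
    (hω : BuffersOmegaSqrt μ A D) :
    Tendsto (fun N : ℕ => probMD μ A (D N) Location.bobSteve N
      (thresholdRegion p (threshold p α N) N)) atTop (𝓝 0) := by
  have hσ := delayVariance_pos hp h2
  have hm := meanDelay_pos hp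
  refine Metric.tendsto_nhds.2 fun η hη => ?_
  -- Makes the Chebyshev term 2σ²/c² equal to η/2; `K` is then the smallest value allowed by
  -- `probMD_threshold_le`.
  set c := √(4 * delayVariance p / η) with hcdef
  have hc : 0 < c := Real.sqrt_pos.2 (by positivity)
  have hc2 : 2 * delayVariance p / c ^ 2 = η / 2 := by
    rw [hcdef, Real.sq_sqrt (by positivity)]
    field_simp
    norm_num
  set K := (√(delayVariance p / α) + c) / meanDelay p
  have hK : 0 ≤ K := by positivity
  have hlim := (hω K).const_sub 1
  rw [sub_self] at hlim
  filter_upwards [hlim.eventually_lt_const (half_pos hη),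
    tendsto_natCast_atTop_atTop.eventually_ge_atTop ((K + 1) ^ 2)] with N h1 hN
  rw [dist_zero_right,
    Real.norm_of_nonneg (show 0 ≤ probMD μ A (D N) _ N _ from measureReal_nonneg)]
  have h := probMD_threshold_le hp hA h2 hα (hD N) hK hc
    (div_mul_cancel₀ _ hm.ne').ge hN
  rw [hc2] at h
  linarith

end

end CovertBuffering

/-! ### Assembly of the three statements -/

theorem mainTheorem3 {Ω : Type*} [MeasurableSpace Ω] (μ : Measure Ω) [IsProbabilityMeasure μ]
    (p : ℝ → ℝ) (hp : CovertBuffering.IsDelayDensity p)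
    (hreg : CovertBuffering.RegularityConditions p)
    (A : ℕ → Ω → ℝ) (hA : CovertBuffering.IsRenewalStream μ p A) :
    -- the constant is the (finite, positive) Fisher information at zero
    (IntegrableOn (fun x => p x * x ^ 2 * (deriv (fun y => Real.log (p y)) x) ^ 2) (Ioi 0) ∧
      IntegrableOn
        (fun x => (deriv (fun r => CovertBuffering.pMinus p x r) 0) ^ 2 / p x) (Ioi 0) ∧
      CovertBuffering.bufferConst p =
        ∫ x in Ioi (0 : ℝ), (deriv (fun r => CovertBuffering.pMinus p x r) 0) ^ 2 / p x ∧
      0 < CovertBuffering.bufferConst p) ∧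
    -- achievability
    (∀ ε ∈ Ioo (0 : ℝ) 1,
      (∀ᶠ N : ℕ in atTop, CovertBuffering.stretchParam p ε N ∈ Ioo (0 : ℝ) 1 ∧
        CovertBuffering.IsBufferingScheme μ A
          (CovertBuffering.stretch A (CovertBuffering.stretchParam p ε N))) ∧
      Tendsto (fun N : ℕ => μ.real {ω | ε * √((N : ℝ) / (4 * CovertBuffering.bufferConst p)) ≤
        CovertBuffering.buffered A
          (CovertBuffering.stretch A (CovertBuffering.stretchParam p ε N)) N ω}) atTop (𝓝 1) ∧
      Tendsto (fun N : ℕ => μ.real {ω | CovertBuffering.buffered A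
          (CovertBuffering.stretch A (CovertBuffering.stretchParam p ε N)) N ω ≤
        ε * √(4 * (N : ℝ) / CovertBuffering.bufferConst p)}) atTop (𝓝 1) ∧
      (∀ᶠ N : ℕ in atTop, ∀ loc : CovertBuffering.Location, ∀ R : Set (Fin N → ℝ),
        MeasurableSet R →
          1 - ε ≤ CovertBuffering.probFA μ A N R +
            CovertBuffering.probMD μ A
              (CovertBuffering.stretch A (CovertBuffering.stretchParam p ε N)) loc N R)) ∧
    -- converse
    (IntegrableOn (fun x => x ^ 2 * p x) (Ioi 0) →
      (∀ α ∈ Ioo (0 : ℝ) 1,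
        (∀ N : ℕ, 1 ≤ N → CovertBuffering.probFA μ A N
          (CovertBuffering.thresholdRegion p (CovertBuffering.threshold p α N) N) ≤ α) ∧
        (∀ D : ℕ → ℕ → Ω → ℝ, (∀ N, CovertBuffering.IsBufferingScheme μ A (D N)) →
          CovertBuffering.BuffersOmegaSqrt μ A D →
          Tendsto (fun N : ℕ => CovertBuffering.probMD μ A (D N)
            CovertBuffering.Location.bobSteve N
            (CovertBuffering.thresholdRegion p (CovertBuffering.threshold p α N) N))
            atTop (𝓝 0))) ∧
      (∀ η : ℝ, 0 < η → ∃ α ∈ Ioo (0 : ℝ) 1,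
        ∀ D : ℕ → ℕ → Ω → ℝ, (∀ N, CovertBuffering.IsBufferingScheme μ A (D N)) →
          CovertBuffering.BuffersOmegaSqrt μ A D →
          ∀ᶠ N : ℕ in atTop,
            CovertBuffering.probFA μ A N
              (CovertBuffering.thresholdRegion p (CovertBuffering.threshold p α N) N) +
            CovertBuffering.probMD μ A (D N) CovertBuffering.Location.bobSteve N
              (CovertBuffering.thresholdRegion p (CovertBuffering.threshold p α N) N) < η)) := by
  have hc := CovertBuffering.bufferConst_pos hp hreg
  refine ⟨⟨CovertBuffering.integrableOn_mul_sq_deriv_log hp hreg,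
    CovertBuffering.integrableOn_sq_deriv_pMinus_div hp hreg, ?_, hc⟩, ?_, ?_⟩
  · rw [CovertBuffering.integral_sq_deriv_pMinus_div hp hreg,
      CovertBuffering.bufferConst_eq hp hreg]
  · rintro ε ⟨hε, -⟩
    refine ⟨?_, CovertBuffering.tendsto_buffered_ge hp hreg hA hε,
      CovertBuffering.tendsto_buffered_le hp hreg hA hε,
      CovertBuffering.eventually_covert hp hreg hA hε⟩
    filter_upwards [eventually_gt_atTop 0,
      (CovertBuffering.tendsto_stretchParam hc ε).eventually_lt_const one_pos] with N hN hρ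
    have h0 := CovertBuffering.stretchParam_pos hc hε hN
    exact ⟨⟨h0, hρ⟩, CovertBuffering.isBufferingScheme_stretch hA h0.le hρ⟩
  · intro h2
    refine ⟨fun α hα => ⟨fun N hN => CovertBuffering.probFA_threshold_le hp hA h2 hα.1 hN,
      fun D hD hω => CovertBuffering.tendsto_probMD_threshold hp hA h2 hα.1 hD hω⟩, ?_⟩
    intro η hη
    have hα : 0 < min (η / 2) (1 / 2) := by positivity
    -- Half of η goes to false alarms and half to missed detections; the 1/2 only keeps α below 1.
    refine ⟨min (η / 2) (1 / 2), ⟨hα, (min_le_right _ _).trans_lt (by norm_num)⟩, ?_⟩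
    intro D hD hω
    filter_upwards [eventually_gt_atTop 0,
      (CovertBuffering.tendsto_probMD_threshold hp hA h2 hα hD hω).eventually_lt_const
        (half_pos hη)] with N hN hMD
    have hFA := CovertBuffering.probFA_threshold_le hp hA h2 hα hN
    linarith [min_le_left (η / 2) (1 / 2 : ℝ)]
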